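/- Let $d\ge 1$, let $\Omega\subset\mathbb R^d$ be compact with $\Omega=\overline{\Omega^\circ}$, and assume that the interior $\Omega^\circ$ is a bounded Lipschitz domain (open, connected, and locally the strict subgraph of a Lipschitz function in suitable orthogonal coordinates). Let $w:\Omega\to[0,\infty)$ be continuous, $\epsilon>0$, $1<\alpha<\frac{d}{d-1}$ (any $\alpha>1$ if $d=1$), $\alpha'=\frac{\alpha}{\alpha-1}$, let $\mu^+,\mu^-$ be Borel probability measures on $\Omega$, and let $\mu=\mu^+-\mu^-$. For $r\in\{\alpha,\alpha'\}$ write $L^r$ and $W^{1,r}$ for the Lebesgue and Sobolev spaces on $\Omega^\circ$, and put $W^{1,r}_\emptyset=\{v\in W^{1,r}:\int_\Omega v\,dx=0\}$. For $q\in L^\alpha(\Omega;\mathbb R^d)$, the equation $\operatorname{div}q=\mu$ means $$-\int_\Omega q\cdot\nabla\varphi\,dx=\int_\Omega\varphi\,d\mu\qquad\text{for all }\varphi\in W^{1,\alpha'},$$ where on the right $\varphi$ is its continuous representative on $\Omega$ (recall $\alpha'>d$). Assume that for every $\nu\in(W^{1,\alpha})^*$ with $\langle\nu,1\rangle=0$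 there is a unique $y\in W^{1,\alpha'}_\emptyset$ with $-\int_\Omega\nabla y\cdot\nabla\varphi\,dx=\langle\nu,\varphi\rangle$ for all $\varphi\in W^{1,\alpha}$. Consider the problem $$(\mathrm{BP}_\epsilon)\qquad \inf\Big\{\int_\Omega w|q|\,dx+\frac{\epsilon}{\alpha}\|q\|_{L^\alpha}^\alpha\ :\ q\in L^\alpha(\Omega;\mathbb R^d),\ \operatorname{div}q=\mu\Big\},$$ let $\partial(w|\cdot|)(q)\subset L^{\alpha'}(\Omega;\mathbb R^d)$ be the subdifferential at $q$ of the convex functional $p\mapsto\int_\Omega w|p|\,dx$ on $L^\alpha(\Omega;\mathbb R^d)$, and define $$F(x,p)=\Big(\tfrac1\epsilon\big(|p|-w(x)\big)\Big)_+^{\alpha'-1}\frac{p}{|p|},\qquad F(x,0)=0 .$$ (1) If $q$ is the solution of $(\mathrm{BP}_\epsilon)$, then there is a Lagrange multiplier $y\in W^{1,\alpha'}_\emptyset$ such that $$0\in\epsilon|q|^{\alpha-2}q+\partial(w|\cdot|)(q)+\nabla y\ \text{ in }L^{\alpha'},\qquad \operatorname{div}q=\mu. \tag{$*$}$$ (2)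 For every $x\in\Omega$, $F(x,\cdot)$ is the single-valued inverse of the multi-valued map $q\mapsto\epsilon|q|^{\alpha-2}q+w(x)\,\partial|\cdot|(q)$ on $\mathbb R^d$: for all $p,q\in\mathbb R^d$, $p\in\epsilon|q|^{\alpha-2}q+w(x)\,\partial|\cdot|(q)$ if and only if $q=F(x,p)$. Moreover $p\mapsto F(\cdot,p(\cdot))$ maps $L^{\alpha'}(\Omega;\mathbb R^d)$ into $L^\alpha(\Omega;\mathbb R^d)$. (3) For all $q\in L^\alpha(\Omega;\mathbb R^d)$ and $y\in W^{1,\alpha'}_\emptyset$, the system $(*)$ holds if and only if $q=F(\cdot,-\nabla y)$ almost everywhere and $\operatorname{div}F(\cdot,-\nabla y)=\mu$. -/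

import Mathlib

open MeasureTheory
open scoped ENNReal RealInnerProductSpace ContDiff

namespace Beckmann

noncomputable section

/-- Euclidean space of dimension `d`. -/
abbrev E (d : ℕ) : Type := EuclideanSpace ℝ (Fin d)

instance factOneLe (α : ℝ) [h : Fact (1 < α)] : Fact (1 ≤ ENNReal.ofReal α) :=
  ⟨by simpa using ENNReal.ofReal_le_ofReal h.out.le⟩

instance factConj (α : ℝ) [h : Fact (1 < α)] : Fact (1 < α.conjExponent) :=
  ⟨(Real.HolderConjugate.conjExponent h.out).symm.lt⟩

/-- `U` is a bounded Lipschitz domain: open, connected, bounded, and near each boundary point,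
in suitable orthogonal coordinates `y = T x`, the set `U` is the strict subgraph
`{y_i < h(y')}` inside the box `{|y_j| < a_j}`, where `h` is a Lipschitz function of the
coordinates `y' = (y_j)_{j ≠ i}` with `|h| ≤ a_i / 2` over the box, and the boundary of `U` is
the graph of `h`. -/
structure IsLipschitzDomain {d : ℕ} (U : Set (E d)) : Prop where
  isOpen : IsOpen U
  isConnected : IsConnected U
  isBounded : Bornology.IsBounded U
  chart : ∀ x ∈ frontier U, ∃ (T : E d ≃ᵃⁱ[ℝ] E d) (i : Fin d) (a : Fin d → ℝ) (h : E d → ℝ),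
    (∀ j, 0 < a j) ∧ (∀ j, |T x j| < a j) ∧
    (∃ K, LipschitzWith K h) ∧
    (∀ y z : E d, (∀ j, j ≠ i → y j = z j) → h y = h z) ∧
    (∀ y : E d, (∀ j, j ≠ i → |y j| < a j) → |h y| ≤ a i / 2) ∧
    (∀ y : E d, (∀ j, |y j| < a j) →
      (T.symm y ∈ U ↔ y i < h y) ∧ (T.symm y ∈ frontier U ↔ y i = h y))

/-- `g` is the weak gradient of `u` on `U` (tested with smooth functions compactly supported
in `U`, in every direction `v`). -/
def HasWeakGradient {d : ℕ} (U : Set (E d)) (u : E d → ℝ) (g : E d → E d) : Prop :=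
  ∀ ψ : E d → ℝ, ContDiff ℝ ∞ ψ → HasCompactSupport ψ → tsupport ψ ⊆ U → ∀ v : E d,
    (∫ x in U, u x * fderiv ℝ ψ x v) = -(∫ x in U, ⟪g x, v⟫ * ψ x)

theorem integrable_mul_test {d : ℕ} {p : ℝ≥0∞} [hp : Fact (1 ≤ p)] {U : Set (E d)}
    {f : E d → ℝ} (hf : MemLp f p (volume.restrict U)) {ψ : E d → ℝ}
    (hψ : Continuous ψ) (hc : HasCompactSupport ψ) :
    Integrable (fun x => f x * ψ x) (volume.restrict U) :=
  (hf.locallyIntegrable hp.out).integrable_smul_right_of_hasCompactSupport hψ hc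

theorem continuous_fderiv_apply {d : ℕ} {ψ : E d → ℝ} (hψ : ContDiff ℝ ∞ ψ) (v : E d) :
    Continuous (fun x => fderiv ℝ ψ x v) :=
  (hψ.continuous_fderiv (by simp)).clm_apply continuous_const

theorem HasWeakGradient.congr {d : ℕ} {U : Set (E d)} {u u' : E d → ℝ} {g g' : E d → E d}
    (h : HasWeakGradient U u g) (hu : u' =ᵐ[volume.restrict U] u)
    (hg : g' =ᵐ[volume.restrict U] g) : HasWeakGradient U u' g' := by
  intro ψ h1 h2 h3 v
  have e1 : ∫ x in U, u' x * fderiv ℝ ψ x v = ∫ x in U, u x * fderiv ℝ ψ x v :=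
    integral_congr_ae (by filter_upwards [hu] with x hx; rw [hx])
  have e2 : ∫ x in U, ⟪g' x, v⟫ * ψ x = ∫ x in U, ⟪g x, v⟫ * ψ x :=
    integral_congr_ae (by filter_upwards [hg] with x hx; rw [hx])
  rw [e1, e2]
  exact h ψ h1 h2 h3 v

theorem HasWeakGradient.add {d : ℕ} {p : ℝ≥0∞} [Fact (1 ≤ p)] {U : Set (E d)}
    {u u' : E d → ℝ} {g g' : E d → E d}
    (hu : MemLp u p (volume.restrict U)) (hu' : MemLp u' p (volume.restrict U))
    (hg : MemLp g p (volume.restrict U)) (hg' : MemLp g' p (volume.restrict U))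
    (h : HasWeakGradient U u g) (h' : HasWeakGradient U u' g') :
    HasWeakGradient U (u + u') (g + g') := by
  intro ψ h1 h2 h3 v
  have c := continuous_fderiv_apply h1 v
  have cs : HasCompactSupport (fun x => fderiv ℝ ψ x v) := h2.fderiv_apply (𝕜 := ℝ) v
  have e1 : ∫ x in U, (u + u') x * fderiv ℝ ψ x v =
      (∫ x in U, u x * fderiv ℝ ψ x v) + ∫ x in U, u' x * fderiv ℝ ψ x v := by
    rw [← integral_add (integrable_mul_test hu c cs) (integrable_mul_test hu' c cs)]
    simp only [Pi.add_apply, add_mul]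
  have e2 : ∫ x in U, ⟪(g + g') x, v⟫ * ψ x =
      (∫ x in U, ⟪g x, v⟫ * ψ x) + ∫ x in U, ⟪g' x, v⟫ * ψ x := by
    rw [← integral_add (integrable_mul_test (hg.inner_const v) h1.continuous h2)
      (integrable_mul_test (hg'.inner_const v) h1.continuous h2)]
    simp only [Pi.add_apply, inner_add_left, add_mul]
  rw [e1, e2, h ψ h1 h2 h3 v, h' ψ h1 h2 h3 v]
  ring

theorem HasWeakGradient.smul {d : ℕ} {U : Set (E d)} {u : E d → ℝ} {g : E d → E d} (c : ℝ)
    (h : HasWeakGradient U u g) : HasWeakGradient U (c • u) (c • g) := by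
  intro ψ h1 h2 h3 v
  simp only [Pi.smul_apply, smul_eq_mul, real_inner_smul_left, mul_assoc, integral_const_mul]
  rw [h ψ h1 h2 h3 v, mul_neg]

/-- The Sobolev space `W^{1,p}(U)`, realised as the space of pairs `(u, ∇u)` in
`L^p(U) × L^p(U; ℝ^d)`, with the norm of that product (equivalent to the usual one). -/
def Sobolev {d : ℕ} (p : ℝ≥0∞) [Fact (1 ≤ p)] (U : Set (E d)) :
    Submodule ℝ (Lp ℝ p (volume.restrict U) × Lp (E d) p (volume.restrict U)) where
  carrier := {z | HasWeakGradient U z.1 z.2}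
  zero_mem' := by
    have h : HasWeakGradient U (0 : E d → ℝ) (0 : E d → E d) := by
      intro ψ _ _ _ v
      simp
    exact h.congr (Lp.coeFn_zero _ _ _) (Lp.coeFn_zero _ _ _)
  add_mem' := fun {a b} ha hb =>
    (HasWeakGradient.add (Lp.memLp a.1) (Lp.memLp b.1) (Lp.memLp a.2) (Lp.memLp b.2) ha hb).congr
      (Lp.coeFn_add a.1 b.1) (Lp.coeFn_add a.2 b.2)
  smul_mem' := fun c a ha =>
    (HasWeakGradient.smul c ha).congr (Lp.coeFn_smul c a.1) (Lp.coeFn_smul c a.2)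

/-- The vector fields of class `L^r` on `Ω`. Here and below Lebesgue integrals over `Ω` are
written over its interior; the boundary of a Lipschitz domain is a Lebesgue null set. -/
abbrev LVec {d : ℕ} (r : ℝ) (Ω : Set (E d)) : Type :=
  Lp (E d) (ENNReal.ofReal r) (volume.restrict (interior Ω))

/-- The Sobolev space `W^{1,r}(Ω)`, for a real exponent `r > 1`. -/
abbrev W1 {d : ℕ} (r : ℝ) [Fact (1 < r)] (Ω : Set (E d)) : Type :=
  Sobolev (ENNReal.ofReal r) (interior Ω)

/-- The function underlying an element of `W^{1,r}`. -/
def W1.val {d : ℕ} {r : ℝ} [Fact (1 < r)] {Ω : Set (E d)} (y : W1 r Ω) : E d → ℝ := y.1.1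

/-- The weak gradient of an element of `W^{1,r}`. -/
def W1.grad {d : ℕ} {r : ℝ} [Fact (1 < r)] {Ω : Set (E d)} (y : W1 r Ω) : LVec r Ω := y.1.2

/-- Membership in the subspace `W^{1,r}_∅` of Sobolev functions with zero mean. -/
def MeanZero {d : ℕ} {r : ℝ} [Fact (1 < r)] {Ω : Set (E d)} (y : W1 r Ω) : Prop :=
  (∫ x in interior Ω, y.val x) = 0

/-- The Neumann problem for the Laplacian is uniquely solvable in `W^{1,α'}_∅`: for every bounded
linear functional `ν` on `W^{1,α}` that vanishes on the constants there is exactly one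
`y ∈ W^{1,α'}_∅` with `- ∫ ∇y · ∇φ = ν(φ)` for all `φ ∈ W^{1,α}`. -/
def NeumannSolvable {d : ℕ} (α : ℝ) [Fact (1 < α)] (Ω : Set (E d)) : Prop :=
  ∀ ν : StrongDual ℝ (W1 α Ω),
    (∀ φ : W1 α Ω, φ.val =ᵐ[volume.restrict (interior Ω)] (fun _ => (1 : ℝ)) → ν φ = 0) →
    ∃! y : W1 α.conjExponent Ω, MeanZero y ∧
      ∀ φ : W1 α Ω, -(∫ x in interior Ω, ⟪y.grad x, φ.grad x⟫) = ν φ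

/-- `div q = μ⁺ - μ⁻` as functionals on `W^{1,α'}(Ω)`, with zero flux through the boundary:
`- ∫ q · ∇φ dx = ∫ φ dμ⁺ - ∫ φ dμ⁻` for all `φ ∈ W^{1,α'}(Ω)`. The measures act on `φ` through
its continuous representative `f` on `Ω` (which exists because `α' > d`, and is unique when `Ω`
is the closure of its interior). -/
def HasDivergence {d : ℕ} (α : ℝ) [Fact (1 < α)] (Ω : Set (E d)) (q : E d → E d)
    (μp μm : Measure (E d)) : Prop :=
  ∀ (φ : W1 α.conjExponent Ω) (f : E d → ℝ), ContinuousOn f Ω →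
    φ.val =ᵐ[volume.restrict (interior Ω)] f →
    -(∫ x in interior Ω, ⟪q x, φ.grad x⟫) = (∫ x in Ω, f x ∂μp) - (∫ x in Ω, f x ∂μm)

/-- The weighted functional `q ↦ ∫ w |q| dx`. -/
def weightedL1 {d : ℕ} (Ω : Set (E d)) (w : E d → ℝ) (q : E d → E d) : ℝ :=
  ∫ x in interior Ω, w x * ‖q x‖

/-- The regularized Beckmann objective `∫ w |q| dx + (ε / α) ‖q‖_{L^α}^α`. -/
def objective {d : ℕ} (α ε : ℝ) (Ω : Set (E d)) (w : E d → ℝ) (q : E d → E d) : ℝ :=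
  weightedL1 Ω w q + ε / α * ∫ x in interior Ω, ‖q x‖ ^ α

/-- `q ∈ L^α` solves the regularized Beckmann problem: it minimizes the objective among all
fields in `L^α` with `div = μ⁺ - μ⁻`. -/
def IsSolution {d : ℕ} (α ε : ℝ) [Fact (1 < α)] (Ω : Set (E d)) (w : E d → ℝ)
    (μp μm : Measure (E d)) (q : LVec α Ω) : Prop :=
  HasDivergence α Ω q μp μm ∧
    ∀ p : LVec α Ω, HasDivergence α Ω p μp μm → objective α ε Ω w q ≤ objective α ε Ω w p

/-- `ξ ∈ L^{α'}` belongs to the subdifferential at `q` of the convex functional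
`p ↦ ∫ w |p| dx` on `L^α`. -/
def InSubdiffWeightedL1 {d : ℕ} (α : ℝ) (Ω : Set (E d)) (w : E d → ℝ) (q : LVec α Ω)
    (ξ : LVec α.conjExponent Ω) : Prop :=
  ∀ p : LVec α Ω,
    weightedL1 Ω w q + (∫ x in interior Ω, ⟪ξ x, p x - q x⟫) ≤ weightedL1 Ω w p

/-- The inclusion `0 ∈ ε |q|^{α-2} q + ∂(w|q|) + ∇y` in `L^{α'}`. -/
def Stationary {d : ℕ} (α ε : ℝ) [Fact (1 < α)] (Ω : Set (E d)) (w : E d → ℝ) (q : LVec α Ω)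
    (y : W1 α.conjExponent Ω) : Prop :=
  ∃ ξ : LVec α.conjExponent Ω, InSubdiffWeightedL1 α Ω w q ξ ∧
    ∀ᵐ x ∂(volume.restrict (interior Ω)),
      (ε * ‖q x‖ ^ (α - 2)) • q x + ξ x + y.grad x = 0

/-- The subdifferential of the Euclidean norm at `q`. -/
def subdiffNorm {d : ℕ} (q : E d) : Set (E d) :=
  {s | ∀ z : E d, ‖q‖ + ⟪s, z - q⟫ ≤ ‖z‖}

/-- The pointwise map `F(x,p) = ((|p| - w(x)) / ε)_+^{α'-1} p / |p|` (with value `0` at `p = 0`). -/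
def F {d : ℕ} (α ε : ℝ) (w : E d → ℝ) (x p : E d) : E d :=
  (max (1 / ε * (‖p‖ - w x)) 0 ^ (α.conjExponent - 1)) • (‖p‖⁻¹ • p)

end

end Beckmann

open Beckmann

/-! The objective `J` is convex and continuous on `L^α`, and its minimizer `q` is in particular
minimal along `q + K`, where `K` is the space of fields orthogonal to all gradients of `W^{1,α'}`.
Separating the strict epigraph of `J` from the slice over `q + K` at height `J q` yields a
subgradient of `J` at `q` that vanishes on `K` (`exists_subgradient_eq_zero_on`); by Riesz
representation it is a field `η` in `L^{α'}`.

The multiplier is found by showing that `-η` is a gradient. A bounded solution operator for the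
Neumann problem makes the gradients a closed subspace of `L^{α'}`. If `-η` were outside it,
Hahn-Banach and the duality of `L^{α'}` with `L^α` would give an element of `K` that does not
annihilate `-η` (`exists_grad_eq_of_orthogonal`).

Integral subgradients are pointwise ones almost everywhere (`ae_subgradient_of_integral`), and the
differentiable power can be subtracted (`subgradient_sub_gradient`), leaving a subgradient of
`w|·|`. The system is then the pointwise inclusion `-∇y ∈ ε|q|^{α-2}q + w ∂|·|(q)`. This is radial:
`|p| = ε|q|^{α-1} + w` when `q ≠ 0`, and `|p| ≤ w` when `q = 0`. Since `(α-1)(α'-1) = 1`, solving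
for `q` gives `F`. -/

namespace Beckmann
open Filter Topology

/-! ### Riesz representation on `L^p` of a finite measure -/

section Duality

variable {X : Type*} [MeasurableSpace X] {μ : Measure X} [IsFiniteMeasure μ]

/-- A continuous linear functional on `L^p` evaluated on indicators has an integrable density. -/
theorem exists_density_of_dual {p : ℝ≥0∞} [Fact (1 ≤ p)] (hp : p ≠ ⊤)
    (g : StrongDual ℝ (Lp ℝ p μ)) :
    ∃ r : X → ℝ, Measurable r ∧ Integrable r μ ∧ ∀ (A : Set X) (hA : MeasurableSet A),
      g (indicatorConstLp p hA (measure_ne_top μ A) 1) = ∫ x in A, r x ∂μ := by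
  classical
  let s : SignedMeasure X :=
  { measureOf' := fun A => if hA : MeasurableSet A then
      g (indicatorConstLp p hA (measure_ne_top μ A) 1) else 0
    empty' := by simp
    not_measurable' := fun A hA => by simp [hA]
    m_iUnion' := fun f hf hd => by
      have hU : MeasurableSet (⋃ i, f i) := MeasurableSet.iUnion hf
      simp only [hf, hU, dite_true]
      refine g.hasSum ?_
      have hF : ∀ t : Finset ℕ, MeasurableSet (⋃ i ∈ t, f i) := fun t =>
        Finset.measurableSet_biUnion _ fun i _ => hf i
      have key : ∀ t : Finset ℕ, ∑ i ∈ t, indicatorConstLp p (hf i) (measure_ne_top μ _) (1 : ℝ) =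
          indicatorConstLp p (hF t) (measure_ne_top μ _) 1 := by
        intro t
        induction t using Finset.induction_on with
        | empty => simp
        | insert a t ha ih =>
          rw [Finset.sum_insert ha, ih, ← indicatorConstLp_disjoint_union]
          · congr 1
            simp
          · rw [Set.disjoint_iUnion₂_right]
            intro i hi
            exact hd (fun h => ha (h ▸ hi))
      have hlim : Tendsto (fun t : Finset ℕ =>
          indicatorConstLp p (hF t) (measure_ne_top μ _) (1 : ℝ)) atTop
          (𝓝 (indicatorConstLp p hU (measure_ne_top μ _) 1)) := by
        refine tendsto_indicatorConstLp_set hp ?_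
        have hsum : ∑' i, μ (f i) ≠ ⊤ := by
          rw [← measure_iUnion hd hf]; exact measure_ne_top _ _
        refine tendsto_of_tendsto_of_tendsto_of_le_of_le tendsto_const_nhds
          (ENNReal.tendsto_tsum_compl_atTop_zero hsum) (fun _ => zero_le) fun t => ?_
        -- The symmetric difference lies in the union of the sets left out of `t`, whose measure is
        -- bounded by the remainder of a convergent series.
        refine le_trans (measure_mono ?_) (measure_iUnion_le (fun i : {i // i ∉ t} => f i))
        rintro x (⟨hx, hx'⟩ | ⟨hx, hx'⟩)
        · simp only [Set.mem_iUnion] at hx hx'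
          obtain ⟨i, _, hi⟩ := hx
          exact absurd ⟨i, hi⟩ hx'
        · simp only [Set.mem_iUnion] at hx hx'
          obtain ⟨i, hi⟩ := hx
          exact Set.mem_iUnion.2 ⟨⟨i, fun h => hx' ⟨i, h, hi⟩⟩, hi⟩
      simpa [HasSum, key] using hlim }
  have hs : ∀ (A : Set X) (hA : MeasurableSet A),
      s A = g (indicatorConstLp p hA (measure_ne_top μ A) 1) := fun A hA => dif_pos hA
  have hac : s ≪ᵥ μ.toENNRealVectorMeasure := by
    refine VectorMeasure.AbsolutelyContinuous.mk fun A hA h0 => ?_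
    rw [Measure.toENNRealVectorMeasure_apply_measurable hA] at h0
    rw [hs A hA]
    have : indicatorConstLp p hA (measure_ne_top μ A) (1 : ℝ) = 0 := by
      rw [← norm_eq_zero]
      refine le_antisymm (norm_indicatorConstLp_le.trans ?_) (norm_nonneg _)
      have : (1 / p.toReal) ≠ 0 := by
        have := ENNReal.toReal_pos (zero_lt_one.trans_le (Fact.out : 1 ≤ p)).ne' hp
        positivity
      rw [Measure.real, h0, ENNReal.toReal_zero, Real.zero_rpow this, mul_zero]
    rw [this, map_zero]
  refine ⟨s.rnDeriv μ, SignedMeasure.measurable_rnDeriv s μ, SignedMeasure.integrable_rnDeriv s μ,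
    fun A hA => ?_⟩
  rw [← hs A hA, ← withDensityᵥ_apply (SignedMeasure.integrable_rnDeriv s μ) hA,
    SignedMeasure.withDensityᵥ_rnDeriv_eq s μ hac]

/-- Functionals on `L^p` are determined by their values on indicators. -/
theorem dual_ext {p : ℝ≥0∞} [Fact (1 ≤ p)] (hp : p ≠ ⊤) (g g' : StrongDual ℝ (Lp ℝ p μ))
    (h : ∀ (A : Set X) (hA : MeasurableSet A),
      g (indicatorConstLp p hA (measure_ne_top μ A) 1) =
        g' (indicatorConstLp p hA (measure_ne_top μ A) 1)) (f : Lp ℝ p μ) : g f = g' f := by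
  induction f using Lp.induction hp with
  | @indicatorConst c s hs hμs =>
    rw [Lp.simpleFunc.coe_indicatorConst]
    have : indicatorConstLp p hs hμs.ne c = c • indicatorConstLp p hs hμs.ne (1 : ℝ) := by
      refine Lp.ext ?_
      filter_upwards [indicatorConstLp_coeFn (p := p) (hs := hs) (hμs := hμs.ne) (c := c),
        indicatorConstLp_coeFn (p := p) (hs := hs) (hμs := hμs.ne) (c := (1 : ℝ)),
        Lp.coeFn_smul c (indicatorConstLp p hs hμs.ne (1 : ℝ))] with x h1 h2 h3
      rw [h1, h3, Pi.smul_apply, h2]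
      by_cases hx : x ∈ s <;> simp [hx]
    rw [this, map_smul, map_smul, h _ hs]
  | add hf hg _ h1 h2 => rw [map_add, map_add, h1, h2]
  | isClosed => exact isClosed_eq g.continuous g'.continuous

instance holderConjugate_ofReal {p q : ℝ} [h : Fact (p.HolderConjugate q)] :
    ENNReal.HolderConjugate (ENNReal.ofReal p) (ENNReal.ofReal q) := h.out.ennrealOfReal

/-- The truncations of the density of a functional on `L^p` are bounded in `L^q`. -/
theorem eLpNorm_truncated_density_le {p q : ℝ} (hpq : p.HolderConjugate q)
    [Fact (1 ≤ ENNReal.ofReal p)]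
    (g : StrongDual ℝ (Lp ℝ (ENNReal.ofReal p) μ)) {r : X → ℝ} (hr : Measurable r)
    (hg : ∀ (A : Set X) (hA : MeasurableSet A),
      g (indicatorConstLp _ hA (measure_ne_top μ A) 1) = ∫ x in A, r x ∂μ) (n : ℕ) :
    eLpNorm ({x | |r x| ≤ n}.indicator r) (ENNReal.ofReal q) μ ≤ ENNReal.ofReal ‖g‖ := by
  have hp0 := hpq.pos
  have hq0 := hpq.symm.pos
  have hq1 := hpq.symm.lt
  have : Fact (p.HolderConjugate q) := ⟨hpq⟩
  have : Fact (1 ≤ ENNReal.ofReal q) := ⟨by simpa using ENNReal.ofReal_le_ofReal hq1.le⟩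
  set A : Set X := {x | |r x| ≤ n} with hAdef
  have hA : MeasurableSet A := measurableSet_le hr.abs measurable_const
  set ρ : X → ℝ := A.indicator r with hρ
  have hρm : Measurable ρ := hr.indicator hA
  have hρb : ∀ x, ‖ρ x‖ ≤ n := by
    intro x
    by_cases hx : x ∈ A
    · rw [hρ, Set.indicator_of_mem hx]; exact hx
    · simp [hρ, hx]
  have hρq : MemLp ρ (ENNReal.ofReal q) μ :=
    MemLp.of_bound hρm.aestronglyMeasurable n (.of_forall hρb)
  have hχ : MemLp (A.indicator fun _ => (1 : ℝ)) ⊤ μ := memLp_indicator_const _ hA _ (by simp)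
  let M := ContinuousLinearMap.mul ℝ ℝ
  -- `g1` restricts `g` to functions supported in `A`, and `g2` integrates against the bounded
  -- function `ρ`. Agreement on indicators extends to all of `L^p`, so `ρ` represents `g` on `A`.
  let g1 : StrongDual ℝ (Lp ℝ (ENNReal.ofReal p) μ) :=
    g ∘L (M.holderL μ ⊤ (ENNReal.ofReal p) (ENNReal.ofReal p) (hχ.toLp _))
  let g2 : StrongDual ℝ (Lp ℝ (ENNReal.ofReal p) μ) :=
    M.lpPairing μ (ENNReal.ofReal q) (ENNReal.ofReal p) (hρq.toLp _)
  have h12 : ∀ f, g1 f = g2 f := by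
    refine dual_ext ENNReal.ofReal_ne_top g1 g2 fun B hB => ?_
    have e1 : M.holderL μ ⊤ (ENNReal.ofReal p) (ENNReal.ofReal p) (hχ.toLp _)
        (indicatorConstLp (ENNReal.ofReal p) hB (measure_ne_top μ B) 1) =
        indicatorConstLp (ENNReal.ofReal p) (hA.inter hB) (measure_ne_top μ _) 1 := by
      refine Lp.ext ?_
      filter_upwards [M.coeFn_holder (r := ENNReal.ofReal p) (hχ.toLp _)
        (indicatorConstLp (ENNReal.ofReal p) hB (measure_ne_top μ B) 1), hχ.coeFn_toLp,
        indicatorConstLp_coeFn (p := ENNReal.ofReal p) (hs := hB) (hμs := measure_ne_top μ B)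
          (c := (1 : ℝ)),
        indicatorConstLp_coeFn (p := ENNReal.ofReal p) (hs := hA.inter hB)
          (hμs := measure_ne_top μ _) (c := (1 : ℝ))] with x h1 h2 h3 h4
      rw [ContinuousLinearMap.holderL_apply_apply, h1, h2, h3, h4]
      by_cases ha : x ∈ A <;> by_cases hb : x ∈ B <;> simp [ha, hb, M]
    have e2 : g2 (indicatorConstLp (ENNReal.ofReal p) hB (measure_ne_top μ B) 1) =
        ∫ x in A ∩ B, r x ∂μ := by
      rw [ContinuousLinearMap.lpPairing_eq_integral, ← integral_indicator (hA.inter hB)]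
      refine integral_congr_ae ?_
      filter_upwards [hρq.coeFn_toLp,
        indicatorConstLp_coeFn (p := ENNReal.ofReal p) (hs := hB) (hμs := measure_ne_top μ B)
          (c := (1 : ℝ))] with x h2 h3
      rw [h2, h3]
      by_cases ha : x ∈ A <;> by_cases hb : x ∈ B <;> simp [ha, hb, M, hρ]
    rw [e2, ← hg _ (hA.inter hB), ← e1]
    rfl
  -- The extremal function in Hölder's inequality: `ρ f = |ρ|^q`, and `|f|^p = |ρ|^q` because
  -- `(q-1)p = q`.
  let f : X → ℝ := fun x => ρ x * |ρ x| ^ (q - 2)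
  have hfabs : ∀ x, |f x| = |ρ x| ^ (q - 1) := by
    intro x
    rcases eq_or_ne (ρ x) 0 with h | h
    · simp [f, h, Real.zero_rpow (by linarith : q - 1 ≠ 0)]
    · have : 0 < |ρ x| := abs_pos.2 h
      rw [show q - 1 = 1 + (q - 2) by ring, Real.rpow_add this, Real.rpow_one]
      simp only [f]
      rw [abs_mul, abs_of_nonneg (Real.rpow_nonneg this.le _)]
  have hfm : Measurable f := hρm.mul (hρm.abs.pow_const _)
  have hfp : MemLp f (ENNReal.ofReal p) μ := by
    refine MemLp.of_bound hfm.aestronglyMeasurable ((n : ℝ) ^ (q - 1)) (.of_forall fun x => ?_)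
    rw [Real.norm_eq_abs, hfabs]
    exact Real.rpow_le_rpow (abs_nonneg _) (hρb x) (by linarith)
  have hρf : ∀ x, ρ x * f x = |ρ x| ^ q := by
    intro x
    rcases eq_or_ne (ρ x) 0 with h | h
    · simp [f, h, Real.zero_rpow (by linarith : q ≠ 0)]
    · have : 0 < |ρ x| := abs_pos.2 h
      have h2 : |ρ x| ^ q = |ρ x| ^ (2 : ℕ) * |ρ x| ^ (q - 2) := by
        rw [← Real.rpow_natCast, ← Real.rpow_add this]; congr 1; push_cast; ring
      rw [h2, sq_abs]; simp only [f]; ring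
  set I : ℝ := ∫ x, |ρ x| ^ q ∂μ with hI
  have hI0 : 0 ≤ I := integral_nonneg fun x => Real.rpow_nonneg (abs_nonneg _) _
  have hgI : g (hfp.toLp f) = I := by
    have e1 : M.holderL μ ⊤ (ENNReal.ofReal p) (ENNReal.ofReal p) (hχ.toLp _) (hfp.toLp f) =
        hfp.toLp f := by
      refine Lp.ext ?_
      filter_upwards [M.coeFn_holder (r := ENNReal.ofReal p) (hχ.toLp _)
        (hfp.toLp f), hχ.coeFn_toLp, hfp.coeFn_toLp] with x h1 h2 h3
      rw [ContinuousLinearMap.holderL_apply_apply, h1, h2, h3]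
      by_cases ha : x ∈ A <;> simp [ha, M, f, hρ]
    have := h12 (hfp.toLp f)
    simp only [g1, g2, ContinuousLinearMap.comp_apply, e1,
      ContinuousLinearMap.lpPairing_eq_integral] at this
    rw [this]
    refine integral_congr_ae ?_
    filter_upwards [hρq.coeFn_toLp, hfp.coeFn_toLp] with x h1 h2
    rw [h1, h2, ← hρf]
    rfl
  have hfn : ‖hfp.toLp f‖ = I ^ p⁻¹ := by
    rw [Lp.norm_toLp, hfp.eLpNorm_eq_integral_rpow_norm (by simpa using hp0) ENNReal.ofReal_ne_top,
      ENNReal.toReal_ofReal hp0.le, ENNReal.toReal_ofReal (by positivity)]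
    congr 1
    refine integral_congr_ae (.of_forall fun x => ?_)
    simp only
    rw [Real.norm_eq_abs, hfabs, ← Real.rpow_mul (abs_nonneg _), hpq.symm.sub_one_mul_conj]
  have hle : I ≤ ‖g‖ * I ^ p⁻¹ := by
    rw [← hfn, ← hgI]
    exact (le_abs_self _).trans (g.le_opNorm _)
  rw [hρq.eLpNorm_eq_integral_rpow_norm (by simpa using hq0) ENNReal.ofReal_ne_top,
    ENNReal.toReal_ofReal hq0.le]
  refine ENNReal.ofReal_le_ofReal ?_
  change I ^ q⁻¹ ≤ ‖g‖
  -- The integral `I` is finite because `ρ` is bounded, so for `I > 0` the factor `I^{1/p}` cancels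
  -- and leaves `I^{1/q} ≤ ‖g‖`.
  rcases hI0.eq_or_lt with h | h
  · rw [← h, Real.zero_rpow (by positivity)]; exact norm_nonneg _
  · have : I = I ^ q⁻¹ * I ^ p⁻¹ := by
      rw [← Real.rpow_add h, add_comm, hpq.inv_add_inv_eq_one, Real.rpow_one]
    rw [this] at hle
    have h' : 0 < I ^ p⁻¹ := Real.rpow_pos_of_pos h _
    rw [← this] at hle
    nth_rewrite 1 [this] at hle
    exact le_of_mul_le_mul_right hle h'

/-- The Riesz representation of functionals on the scalar space `L^p` of a finite measure. -/
theorem exists_Lp_repr_dual {p q : ℝ} (hpq : p.HolderConjugate q)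
    [Fact (1 ≤ ENNReal.ofReal p)] [Fact (1 ≤ ENNReal.ofReal q)]
    (g : StrongDual ℝ (Lp ℝ (ENNReal.ofReal p) μ)) :
    ∃ r : Lp ℝ (ENNReal.ofReal q) μ, ∀ f, g f = ∫ x, r x * f x ∂μ := by
  have : Fact (p.HolderConjugate q) := ⟨hpq⟩
  obtain ⟨r, hr, -, hg⟩ := exists_density_of_dual ENNReal.ofReal_ne_top g
  have hmem : MemLp r (ENNReal.ofReal q) μ := by
    refine ⟨hr.aestronglyMeasurable, ?_⟩
    -- Fatou's lemma carries the uniform bound on the truncations over to `r`.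
    have hlim := Lp.eLpNorm_lim_le_liminf_eLpNorm (μ := μ) (p := ENNReal.ofReal q)
      (f := fun n : ℕ => {x | |r x| ≤ n}.indicator r)
      (fun n => (hr.indicator (measurableSet_le hr.abs measurable_const)).aestronglyMeasurable) r
      (.of_forall fun x => by
        obtain ⟨N, hN⟩ := exists_nat_ge |r x|
        refine tendsto_const_nhds.congr' ?_
        filter_upwards [eventually_ge_atTop N] with n hn
        have : x ∈ {x | |r x| ≤ n} := hN.trans (by exact_mod_cast hn)
        simp only [Set.indicator_of_mem this])
    refine lt_of_le_of_lt (hlim.trans (liminf_le_of_le (by isBoundedDefault)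
      (a := ENNReal.ofReal ‖g‖) fun b hb => ?_)) ENNReal.ofReal_lt_top
    obtain ⟨n, hn⟩ := hb.exists
    exact hn.trans (eLpNorm_truncated_density_le hpq g hr hg n)
  refine ⟨hmem.toLp r, fun f => ?_⟩
  have := dual_ext ENNReal.ofReal_ne_top g ((ContinuousLinearMap.mul ℝ ℝ).lpPairing μ
    (ENNReal.ofReal q) (ENNReal.ofReal p) (hmem.toLp r)) (fun A hA => by
      rw [hg A hA, ContinuousLinearMap.lpPairing_eq_integral, ← integral_indicator hA]
      refine integral_congr_ae ?_
      filter_upwards [hmem.coeFn_toLp, indicatorConstLp_coeFn (p := ENNReal.ofReal p) (hs := hA)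
        (hμs := measure_ne_top μ A) (c := (1 : ℝ))] with x h1 h2
      rw [h1, h2]
      by_cases ha : x ∈ A <;> simp [ha]) f
  rw [this, ContinuousLinearMap.lpPairing_eq_integral]
  rfl

/-- The Riesz representation of functionals on the space of `L^p` vector fields. -/
theorem exists_LpVec_repr_dual {d : ℕ} {p q : ℝ} (hpq : p.HolderConjugate q)
    [Fact (1 ≤ ENNReal.ofReal p)] [Fact (1 ≤ ENNReal.ofReal q)]
    (g : StrongDual ℝ (Lp (E d) (ENNReal.ofReal p) μ)) :
    ∃ r : Lp (E d) (ENNReal.ofReal q) μ, ∀ f, g f = ∫ x, ⟪r x, f x⟫ ∂μ := by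
  have : Fact (p.HolderConjugate q) := ⟨hpq⟩
  let e : Fin d → E d := fun i => EuclideanSpace.single i 1
  let J : Fin d → (ℝ →L[ℝ] E d) := fun i => ContinuousLinearMap.toSpanSingleton ℝ (e i)
  let π : Fin d → (E d →L[ℝ] ℝ) := fun i => innerSL ℝ (e i)
  choose r hr using fun i => exists_Lp_repr_dual hpq (μ := μ)
    (g ∘L (J i).compLpL (ENNReal.ofReal p) μ)
  have hsum : ∀ v : E d, ∑ i, J i (π i v) = v := by
    intro v
    ext j
    simp [J, π, e, EuclideanSpace.inner_single_left, Pi.single_apply]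
  refine ⟨∑ i, (J i).compLp (r i), fun f => ?_⟩
  have hf : f = ∑ i, (J i).compLp ((π i).compLp f) := by
    refine Lp.ext ?_
    have h1 : ∀ᵐ x ∂μ, ∀ i, (J i).compLp ((π i).compLp f) x = J i (π i (f x)) := by
      rw [ae_all_iff]; intro i
      filter_upwards [(J i).coeFn_compLp ((π i).compLp f), (π i).coeFn_compLp f] with x h1 h2
      rw [h1, h2]
    filter_upwards [h1, Lp.coeFn_finsetSum Finset.univ fun i => (J i).compLp ((π i).compLp f)]
      with x h1 h2
    rw [h2, Finset.sum_apply, Finset.sum_congr rfl fun i _ => h1 i, hsum]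
  have hgf : g f = ∑ i, ∫ x, r i x * (π i).compLp f x ∂μ := by
    conv_lhs => rw [hf]
    rw [map_sum]
    exact Finset.sum_congr rfl fun i _ => hr i ((π i).compLp f)
  have hint : ∀ i, Integrable (fun x => r i x * (π i).compLp f x) μ := fun i =>
    memLp_one_iff_integrable.1 ((ContinuousLinearMap.mul ℝ ℝ).memLp_of_bilin 1
      (Lp.memLp (r i)) (Lp.memLp ((π i).compLp f)))
  rw [hgf, ← integral_finsetSum _ fun i _ => hint i]
  refine integral_congr_ae ?_
  have h1 : ∀ᵐ x ∂μ, ∀ i, (J i).compLp (r i) x = J i (r i x) ∧ (π i).compLp f x = π i (f x) := by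
    rw [ae_all_iff]; intro i
    filter_upwards [(J i).coeFn_compLp (r i), (π i).coeFn_compLp f] with x h1 h2
    exact ⟨h1, h2⟩
  filter_upwards [h1, Lp.coeFn_finsetSum Finset.univ fun i => (J i).compLp (r i)] with x h1 h2
  rw [h2, Finset.sum_apply, sum_inner]
  refine Finset.sum_congr rfl fun i _ => ?_
  rw [(h1 i).1, (h1 i).2]
  simp [J, π, inner_smul_left]

end Duality

/-! ### Sobolev spaces, the Neumann problem and closedness of gradients -/

section SobolevSpace

variable {d : ℕ}

instance factHolder (α : ℝ) [h : Fact (1 < α)] : Fact (α.HolderConjugate α.conjExponent) :=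
  ⟨Real.HolderConjugate.conjExponent h.out⟩

instance factHolder_symm (α : ℝ) [h : Fact (1 < α)] : Fact (α.conjExponent.HolderConjugate α) :=
  ⟨(Real.HolderConjugate.conjExponent h.out).symm⟩

/-- Each test identity equates two continuous functionals of the pair, since test functions lie in
the conjugate space. The resulting completeness is what the closed graph theorem needs. -/
theorem isClosed_sobolev (p : ℝ≥0∞) [hp : Fact (1 ≤ p)] (U : Set (E d)) :
    IsClosed (Sobolev p U :
      Set (Lp ℝ p (volume.restrict U) × Lp (E d) p (volume.restrict U))) := by
  have hq : Fact (1 ≤ p.conjExponent) := ⟨by simp [ENNReal.conjExponent]⟩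
  have h : (Sobolev p U : Set (Lp ℝ p (volume.restrict U) × Lp (E d) p (volume.restrict U))) =
      {z | HasWeakGradient U z.1 z.2} := rfl
  rw [h]
  simp only [HasWeakGradient, Set.ofPred_forall]
  refine isClosed_iInter fun ψ => isClosed_iInter fun h1 => isClosed_iInter fun h2 =>
    isClosed_iInter fun _ => isClosed_iInter fun v => isClosed_eq ?_ (Continuous.neg ?_)
  · have hm : MemLp (fun x => fderiv ℝ ψ x v) p.conjExponent (volume.restrict U) :=
      (continuous_fderiv_apply h1 v).memLp_of_hasCompactSupport (h2.fderiv_apply (𝕜 := ℝ) v)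
    have hc : Continuous fun z : Lp ℝ p (volume.restrict U) × Lp (E d) p (volume.restrict U) =>
        (ContinuousLinearMap.mul ℝ ℝ).lpPairing (volume.restrict U) p p.conjExponent z.1
          (hm.toLp _) := by fun_prop
    refine hc.congr fun z => ?_
    rw [ContinuousLinearMap.lpPairing_eq_integral]
    refine integral_congr_ae ?_
    filter_upwards [hm.coeFn_toLp] with x hx
    rw [hx]; rfl
  · have hm : MemLp (fun x => ψ x • v) p.conjExponent (volume.restrict U) :=
      (h1.continuous.smul continuous_const).memLp_of_hasCompactSupport h2.smul_right
    have hc : Continuous fun z : Lp ℝ p (volume.restrict U) × Lp (E d) p (volume.restrict U) =>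
        (innerSL ℝ).lpPairing (volume.restrict U) p p.conjExponent z.2 (hm.toLp _) := by fun_prop
    refine hc.congr fun z => ?_
    rw [ContinuousLinearMap.lpPairing_eq_integral]
    refine integral_congr_ae ?_
    filter_upwards [hm.coeFn_toLp] with x hx
    rw [hx, innerSL_apply_apply, inner_smul_right, mul_comm]

instance (p : ℝ≥0∞) [Fact (1 ≤ p)] (U : Set (E d)) : CompleteSpace (Sobolev p U) :=
  (isClosed_sobolev p U).completeSpace_coe

variable {Ω : Set (E d)}

/-- The gradient as a bounded operator on `W^{1,r}`. -/
noncomputable def gradL (r : ℝ) [Fact (1 < r)] (Ω : Set (E d)) : W1 r Ω →L[ℝ] LVec r Ω :=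
  (ContinuousLinearMap.snd ℝ _ _).comp
    (Sobolev (ENNReal.ofReal r) (interior Ω)).subtypeL

@[simp]
theorem gradL_apply {r : ℝ} [Fact (1 < r)] (φ : W1 r Ω) : gradL r Ω φ = φ.grad := rfl

/-- The integral pairing between vector fields of conjugate integrability. -/
noncomputable def pairing (p q : ℝ) [Fact (p.HolderConjugate q)] [Fact (1 ≤ ENNReal.ofReal p)]
    [Fact (1 ≤ ENNReal.ofReal q)] (Ω : Set (E d)) : LVec p Ω →L[ℝ] LVec q Ω →L[ℝ] ℝ :=
  (innerSL ℝ).lpPairing (volume.restrict (interior Ω)) (ENNReal.ofReal p) (ENNReal.ofReal q)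

theorem pairing_apply {p q : ℝ} [Fact (p.HolderConjugate q)] [Fact (1 ≤ ENNReal.ofReal p)]
    [Fact (1 ≤ ENNReal.ofReal q)] (f : LVec p Ω) (g : LVec q Ω) :
    pairing p q Ω f g = ∫ x in interior Ω, ⟪f x, g x⟫ := by
  rw [pairing, ContinuousLinearMap.lpPairing_eq_integral]
  rfl

theorem hasWeakGradient_const (U : Set (E d)) (c : ℝ) :
    HasWeakGradient U (fun _ => c) (fun _ => 0) := by
  intro ψ h1 h2 h3 v
  have h0 : Integrable (fun x => fderiv ℝ ψ x v) :=
    (continuous_fderiv_apply h1 v).integrable_of_hasCompactSupport (h2.fderiv_apply (𝕜 := ℝ) v)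
  have hsupp : ∫ x in U, c * fderiv ℝ ψ x v = ∫ x, c * fderiv ℝ ψ x v := by
    refine setIntegral_eq_integral_of_forall_compl_eq_zero fun x hx => ?_
    have : x ∉ tsupport ψ := fun h => hx (h3 h)
    rw [fderiv_of_notMem_tsupport (𝕜 := ℝ) this]
    simp
  have := integral_mul_fderiv_eq_neg_fderiv_mul_of_integrable (μ := (volume : Measure (E d)))
    (f := fun _ => c) (g := ψ) (v := v) (by simp) (h0.const_mul c)
    ((h1.continuous.integrable_of_hasCompactSupport h2).const_mul c)
    (fun x _ => differentiableAt_const c) (fun x _ => h1.differentiable (by simp) x)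
  rw [hsupp, this]
  simp

theorem exists_const_W1 (r : ℝ) [Fact (1 < r)] (hΩ : Bornology.IsBounded (interior Ω)) (c : ℝ) :
    ∃ φ : W1 r Ω, φ.val =ᵐ[volume.restrict (interior Ω)] (fun _ => c) ∧ φ.grad = 0 := by
  have : IsFiniteMeasure (volume.restrict (interior Ω)) := ⟨by simpa using hΩ.measure_lt_top⟩
  have hm : MemLp (fun _ : E d => c) (ENNReal.ofReal r) (volume.restrict (interior Ω)) :=
    memLp_const c
  refine ⟨⟨(hm.toLp _, 0), ?_⟩, hm.coeFn_toLp, rfl⟩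
  exact (hasWeakGradient_const _ c).congr hm.coeFn_toLp (Lp.coeFn_zero _ _ _)

/-- Comparison with the zero weak gradient of a constant shows that the gradient integrates to zero
against every test function. Hence `φ ↦ ∫ η · ∇φ` kills constants and is admissible data for the
Neumann problem. -/
theorem grad_eq_zero_of_val_ae_const {r : ℝ} [Fact (1 < r)] (φ : W1 r Ω) (c : ℝ)
    (h : φ.val =ᵐ[volume.restrict (interior Ω)] (fun _ => c)) : φ.grad = 0 := by
  have hloc : LocallyIntegrable φ.grad (volume.restrict (interior Ω)) :=
    (Lp.memLp φ.grad).locallyIntegrable Fact.out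
  have key : ∀ᵐ x, x ∈ interior Ω → φ.grad x = 0 := by
    refine isOpen_interior.ae_eq_zero_of_integral_contDiff_smul_eq_zero
      (locallyIntegrableOn_of_locallyIntegrable_restrict hloc) ?_
    intro ψ h1 h2 h3
    have hsupp : ∫ x in interior Ω, ψ x • φ.grad x = ∫ x, ψ x • φ.grad x := by
      refine setIntegral_eq_integral_of_forall_compl_eq_zero fun x hx => ?_
      have : x ∉ tsupport ψ := fun h => hx (h3 h)
      rw [image_eq_zero_of_notMem_tsupport this, zero_smul]
    rw [← hsupp]
    have hint : Integrable (fun x => ψ x • φ.grad x) (volume.restrict (interior Ω)) :=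
      hloc.integrable_smul_left_of_hasCompactSupport h1.continuous h2
    refine ext_inner_left ℝ fun v => ?_
    rw [inner_zero_right, ← integral_inner hint]
    have e1 := φ.2 ψ h1 h2 h3 v
    have e2 := hasWeakGradient_const (interior Ω) c ψ h1 h2 h3 v
    have e3 : ∫ x in interior Ω, φ.1.1 x * fderiv ℝ ψ x v =
        ∫ x in interior Ω, c * fderiv ℝ ψ x v :=
      integral_congr_ae (by filter_upwards [h] with x hx; rw [← hx]; rfl)
    rw [e3, e2] at e1
    simp only [inner_zero_left, zero_mul, integral_zero, neg_zero, zero_eq_neg] at e1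
    rw [← e1]
    refine integral_congr_ae (.of_forall fun x => ?_)
    simp only [inner_smul_right, real_inner_comm v, mul_comm (ψ x)]
    rfl
  refine Lp.ext ?_
  filter_upwards [(ae_restrict_iff' isOpen_interior.measurableSet).2 key,
    Lp.coeFn_zero (E d) (ENNReal.ofReal r) (volume.restrict (interior Ω))] with x h1 h2
  rw [h1, h2]; rfl

theorem exists_integral_clm (r : ℝ) [Fact (1 < r)] (hΩ : Bornology.IsBounded (interior Ω)) :
    ∃ m : W1 r Ω →L[ℝ] ℝ, ∀ y, m y = ∫ x in interior Ω, y.val x := by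
  have : IsFiniteMeasure (volume.restrict (interior Ω)) := ⟨by simpa using hΩ.measure_lt_top⟩
  have hm : MemLp (fun _ : E d => (1 : ℝ)) (ENNReal.ofReal r.conjExponent)
    (volume.restrict (interior Ω)) := memLp_const 1
  refine ⟨(((ContinuousLinearMap.mul ℝ ℝ).lpPairing (volume.restrict (interior Ω))
    (ENNReal.ofReal r.conjExponent) (ENNReal.ofReal r) (hm.toLp _)).comp
      (ContinuousLinearMap.fst ℝ _ _)).comp
        (Sobolev (ENNReal.ofReal r) (interior Ω)).subtypeL, fun y => ?_⟩
  simp only [ContinuousLinearMap.comp_apply, ContinuousLinearMap.lpPairing_eq_integral]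
  refine integral_congr_ae ?_
  filter_upwards [hm.coeFn_toLp] with x hx
  rw [hx]
  exact one_mul _

/-- Subtracting the mean does not change the gradient. -/
theorem exists_meanZero_grad_eq {r : ℝ} [Fact (1 < r)] (hΩ : Bornology.IsBounded (interior Ω))
    (φ : W1 r Ω) : ∃ ψ : W1 r Ω, MeanZero ψ ∧ ψ.grad = φ.grad := by
  obtain ⟨m, hm⟩ := exists_integral_clm r hΩ
  obtain ⟨o, ho, hog⟩ := exists_const_W1 r hΩ 1
  have hmo : m o = (volume (interior Ω)).toReal := by
    rw [hm, integral_congr_ae ho]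
    simp [Measure.real]
  refine ⟨φ - (m φ / m o) • o, ?_, ?_⟩
  · rw [MeanZero, ← hm, map_sub, map_smul, smul_eq_mul]
    -- If the interior is null, division by zero gives coefficient `0`, and every mean vanishes
    -- anyway.
    rcases eq_or_ne (m o) 0 with h | h
    · have h0 : volume (interior Ω) = 0 := by
        rw [hmo, ENNReal.toReal_eq_zero_iff] at h
        exact h.resolve_right hΩ.measure_lt_top.ne
      have h1 : ∫ x in interior Ω, φ.val x = 0 := setIntegral_measure_zero _ h0
      rw [hm φ, h1, h, mul_zero, sub_zero]
    · rw [div_mul_cancel₀ _ h, sub_self]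
  · have h1 : gradL r Ω ((m φ / m o) • o) = 0 := by
      rw [map_smul, gradL_apply, hog, smul_zero]
    have h2 := (gradL r Ω).map_sub φ ((m φ / m o) • o)
    rw [h1, sub_zero] at h2
    exact h2

/-- A uniquely solvable linear equation has a bounded solution operator, by the closed graph
theorem. -/
theorem exists_solution_clm {X Y Z : Type*} [NormedAddCommGroup X] [NormedSpace ℝ X]
    [CompleteSpace X] [NormedAddCommGroup Y] [NormedSpace ℝ Y] [CompleteSpace Y]
    [NormedAddCommGroup Z] [NormedSpace ℝ Z] (G : Y →L[ℝ] X) (ν : X →L[ℝ] Z →L[ℝ] ℝ)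
    (m : Y →L[ℝ] ℝ) (h : ∀ η, ∃! y, m y = 0 ∧ ∀ φ, -(ν (G y) φ) = ν η φ) :
    ∃ S : X →L[ℝ] Y, ∀ y, m y = 0 → S (G y) = -y := by
  choose S hS hSu using h
  let T : X →ₗ[ℝ] Y :=
    { toFun := S
      map_add' := fun a b => by
        refine (hSu (a + b) (S a + S b) ⟨?_, fun φ => ?_⟩).symm
        · rw [map_add, (hS a).1, (hS b).1, add_zero]
        · rw [map_add, ν.map_add₂, ν.map_add₂, ← (hS a).2, ← (hS b).2, neg_add]
      map_smul' := fun c a => by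
        refine (hSu (c • a) (c • S a) ⟨?_, fun φ => ?_⟩).symm
        · rw [map_smul, (hS a).1, smul_zero]
        · rw [map_smul, ν.map_smul₂, ν.map_smul₂, ← (hS a).2, smul_neg] }
  -- The equation and the constraint survive limits in datum and solution, so uniqueness identifies
  -- the limit with the value of `S` there.
  have hcont : Continuous T := by
    refine T.continuous_of_seq_closed_graph fun u η y hu hy => hSu η y ⟨?_, fun φ => ?_⟩
    · refine tendsto_nhds_unique ((m.continuous.tendsto y).comp hy) ?_
      exact tendsto_const_nhds.congr fun n => (hS (u n)).1.symm
    · have h1 : Continuous fun y => -(ν (G y) φ) := by fun_prop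
      have h2 : Continuous fun η => ν η φ := by fun_prop
      exact tendsto_nhds_unique ((h1.tendsto y).comp hy)
        (((h2.tendsto η).comp hu).congr fun n => ((hS (u n)).2 φ).symm)
  -- The equation carries a minus sign, so the datum `G y` is solved by `-y`.
  refine ⟨⟨T, hcont⟩, fun y hy => (hSu _ (-y) ⟨?_, fun φ => ?_⟩).symm⟩
  · rw [map_neg, hy, neg_zero]
  · rw [map_neg, ν.map_neg₂, neg_neg]

/-- The Neumann problem with right-hand side `φ ↦ ∫ η · ∇φ` has a bounded solution operator. -/
theorem exists_neumann_clm (α : ℝ) [Fact (1 < α)] (hΩ : Bornology.IsBounded (interior Ω))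
    (hN : NeumannSolvable α Ω) :
    ∃ S : LVec α.conjExponent Ω →L[ℝ] W1 α.conjExponent Ω,
      ∀ y : W1 α.conjExponent Ω, MeanZero y → S y.grad = -y := by
  let ν : LVec α.conjExponent Ω →L[ℝ] W1 α Ω →L[ℝ] ℝ :=
    (ContinuousLinearMap.precomp ℝ (gradL α Ω)).comp (pairing α.conjExponent α Ω)
  have hν : ∀ η φ, ν η φ = pairing α.conjExponent α Ω η φ.grad := fun _ _ => rfl
  obtain ⟨m, hm⟩ := exists_integral_clm α.conjExponent hΩ
  obtain ⟨S, hS⟩ := exists_solution_clm (gradL α.conjExponent Ω) ν m fun η => by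
    have := hN (ν η) fun φ hφ => by
      rw [hν, grad_eq_zero_of_val_ae_const φ 1 hφ, map_zero]
    simpa only [hν, hm, MeanZero, pairing_apply, gradL_apply] using this
  exact ⟨S, fun y hy => hS y ((hm y).trans hy)⟩

/-- Solvability of the Neumann problem makes the space of gradients closed in `L^{α'}`. -/
theorem isClosed_range_grad (α : ℝ) [Fact (1 < α)] (hΩ : Bornology.IsBounded (interior Ω))
    (hN : NeumannSolvable α Ω) :
    IsClosed ((LinearMap.range (gradL α.conjExponent Ω).toLinearMap :
      Submodule ℝ (LVec α.conjExponent Ω)) : Set (LVec α.conjExponent Ω)) := by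
  obtain ⟨S, hS⟩ := exists_neumann_clm α hΩ hN
  -- The range is the fixed-point set of the continuous map `η ↦ ∇(-S η)`, hence closed.
  have : ((LinearMap.range (gradL α.conjExponent Ω).toLinearMap :
      Submodule ℝ (LVec α.conjExponent Ω)) : Set (LVec α.conjExponent Ω)) =
      {η | gradL α.conjExponent Ω (-S η) = η} := by
    ext η
    constructor
    · rintro ⟨φ, rfl⟩
      obtain ⟨ψ, h0, hψ⟩ := exists_meanZero_grad_eq hΩ φ
      have h1 := hS ψ h0
      rw [hψ] at h1
      change gradL α.conjExponent Ω (-S φ.grad) = φ.grad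
      rw [h1, neg_neg, gradL_apply, hψ]
    · intro h
      exact ⟨-S η, h⟩
  rw [this]
  exact isClosed_eq (by fun_prop) continuous_id

/-- A field in `L^{α'}` orthogonal to all `L^α` fields that annihilate gradients is a gradient. -/
theorem exists_grad_eq_of_orthogonal (α : ℝ) [Fact (1 < α)]
    (hΩ : Bornology.IsBounded (interior Ω)) (hN : NeumannSolvable α Ω)
    (η : LVec α.conjExponent Ω)
    (hη : ∀ r : LVec α Ω, (∀ φ : W1 α.conjExponent Ω, pairing α α.conjExponent Ω r φ.grad = 0) →
      pairing α α.conjExponent Ω r η = 0) :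
    ∃ y : W1 α.conjExponent Ω, MeanZero y ∧ y.grad = η := by
  have : IsFiniteMeasure (volume.restrict (interior Ω)) := ⟨by simpa using hΩ.measure_lt_top⟩
  by_cases h : η ∈ LinearMap.range (gradL α.conjExponent Ω).toLinearMap
  · obtain ⟨φ, hφ⟩ := h
    obtain ⟨y, hy, hyg⟩ := exists_meanZero_grad_eq hΩ φ
    exact ⟨y, hy, hyg.trans hφ⟩
  exfalso
  obtain ⟨f, u, hf, hu⟩ := geometric_hahn_banach_closed_point
    (LinearMap.range (gradL α.conjExponent Ω).toLinearMap).convex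
    (isClosed_range_grad α hΩ hN) h
  have hf0 : ∀ φ : W1 α.conjExponent Ω, f φ.grad = 0 := by
    intro φ
    by_contra hne
    -- The multiple is scaled so that `f` takes exactly the value `u`, while `f < u` on the
    -- subspace.
    have := hf (gradL _ Ω ((u / f φ.grad) • φ)) ⟨_, rfl⟩
    rw [map_smul, map_smul, gradL_apply, smul_eq_mul, div_mul_cancel₀ _ hne] at this
    exact lt_irrefl _ this
  have hu0 : 0 < u := by
    have := hf 0 (Submodule.zero_mem _)
    rwa [map_zero] at this
  obtain ⟨r, hr⟩ := exists_LpVec_repr_dual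
    (Fact.out : α.conjExponent.HolderConjugate α) f
  have hr' : ∀ v, pairing α α.conjExponent Ω r v = f v := fun v => by
    rw [hr, pairing_apply]
  have := hη r fun φ => by rw [hr', hf0]
  rw [hr'] at this
  linarith

end SobolevSpace

/-! ### Subgradients of the norm and abstract convex separation -/

section Pointwise

variable {d : ℕ}

/-- Testing with `z = 0` and `z = 2q` fixes the inner product, and `z = s` bounds the norm. The
converse is Cauchy-Schwarz. -/
theorem mem_subdiffNorm_iff {q s : E d} : s ∈ subdiffNorm q ↔ ‖s‖ ≤ 1 ∧ ⟪s, q⟫ = ‖q‖ := by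
  constructor
  · intro h
    have h0 : ‖q‖ + ⟪s, (0 : E d) - q⟫ ≤ ‖(0 : E d)‖ := h 0
    have h2 : ‖q‖ + ⟪s, (2 : ℝ) • q - q⟫ ≤ ‖(2 : ℝ) • q‖ := h _
    rw [norm_smul, inner_sub_right, inner_smul_right, Real.norm_ofNat] at h2
    rw [inner_sub_right, inner_zero_right, norm_zero] at h0
    have hq : ⟪s, q⟫ = ‖q‖ := by linarith
    have hs : ‖q‖ + ⟪s, s - q⟫ ≤ ‖s‖ := h s
    rw [inner_sub_right, hq, real_inner_self_eq_norm_sq] at hs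
    exact ⟨by nlinarith [norm_nonneg s], hq⟩
  · rintro ⟨h1, h2⟩ z
    have := real_inner_le_norm s z
    rw [inner_sub_right, h2]
    nlinarith [norm_nonneg z]

/-- The equality case of Cauchy-Schwarz: expanding the square gives `‖s - q/|q|‖² = ‖s‖² - 1 ≤ 0`.
-/
theorem mem_subdiffNorm_iff_of_ne_zero {q s : E d} (hq : q ≠ 0) :
    s ∈ subdiffNorm q ↔ s = ‖q‖⁻¹ • q := by
  have hn : ‖q‖ ≠ 0 := norm_ne_zero_iff.2 hq
  rw [mem_subdiffNorm_iff]
  constructor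
  · rintro ⟨h1, h2⟩
    rw [← sub_eq_zero, ← norm_eq_zero, ← sq_eq_zero_iff]
    refine le_antisymm ?_ (sq_nonneg _)
    rw [norm_sub_sq_real, inner_smul_right, h2, inv_mul_cancel₀ hn, norm_smul, norm_inv, norm_norm,
      inv_mul_cancel₀ hn]
    nlinarith [norm_nonneg s]
  · rintro rfl
    rw [norm_smul, norm_inv, norm_norm, inv_mul_cancel₀ hn, inner_smul_left,
      real_inner_self_eq_norm_sq]
    refine ⟨le_rfl, ?_⟩
    simp only [conj_trivial]
    field_simp

theorem normalize_mem_subdiffNorm (q : E d) : ‖q‖⁻¹ • q ∈ subdiffNorm q := by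
  rcases eq_or_ne q 0 with rfl | h
  · simp [mem_subdiffNorm_iff]
  · exact (mem_subdiffNorm_iff_of_ne_zero h).2 rfl

/-- For `W > 0` one divides by `W`. For `W = 0` the test point `q + ξ` forces `ξ = 0`, and any
subgradient of the norm serves as `s`. -/
theorem subgradient_smul_norm_iff {W : ℝ} (hW : 0 ≤ W) {q ξ : E d} :
    (∀ z, W * ‖q‖ + ⟪ξ, z - q⟫ ≤ W * ‖z‖) ↔ ∃ s ∈ subdiffNorm q, ξ = W • s := by
  constructor
  · intro h
    rcases hW.eq_or_lt with rfl | hW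
    · refine ⟨_, normalize_mem_subdiffNorm q, ?_⟩
      have := h (q + ξ)
      rw [add_sub_cancel_left, real_inner_self_eq_norm_sq] at this
      have : ‖ξ‖ = 0 := by
        rw [← sq_eq_zero_iff]; exact le_antisymm (by linarith) (sq_nonneg _)
      rw [zero_smul]; exact norm_eq_zero.1 this
    · refine ⟨W⁻¹ • ξ, fun z => ?_, by rw [smul_inv_smul₀ hW.ne']⟩
      rw [inner_smul_left, conj_trivial]
      have := mul_le_mul_of_nonneg_left (h z) (inv_nonneg.2 hW.le)
      rwa [mul_add, inv_mul_cancel_left₀ hW.ne', inv_mul_cancel_left₀ hW.ne'] at this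
  · rintro ⟨s, hs, rfl⟩ z
    have := mul_le_mul_of_nonneg_left (hs z) hW
    rwa [mul_add, ← real_inner_smul_left] at this

/-- For `q ≠ 0` the vectors `p` and `q` have the same direction, which leaves the scalar equation
`|p| = ε|q|^{α-1} + w(x)`, inverted by the power `α'-1`. The value `q = 0` absorbs exactly the ball
`|p| ≤ w(x)`. -/
theorem exists_subgradient_iff_eq_F {α ε : ℝ} (hα : 1 < α) (hε : 0 < ε) {w : E d → ℝ} {x : E d}
    (hw : 0 ≤ w x) (p q : E d) :
    (∃ s ∈ subdiffNorm q, p = (ε * ‖q‖ ^ (α - 2)) • q + w x • s) ↔ q = F α ε w x p := by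
  have hc := Real.HolderConjugate.conjExponent hα
  have hβ : α.conjExponent - 1 ≠ 0 := by linarith [hc.symm.lt]
  have hpow : (α - 1) * (α.conjExponent - 1) = 1 := by
    have := hc.sub_one_mul_conj
    rw [mul_sub, this]; ring
  have h3 : ∀ t : ℝ, 0 < t → t ^ (α - 2) * t = t ^ (α - 1) := fun t ht => by
    nth_rewrite 2 [← Real.rpow_one t]
    rw [← Real.rpow_add ht]; congr 1; ring
  constructor
  · rintro ⟨s, hs, rfl⟩
    rcases eq_or_ne q 0 with rfl | hq
    · rw [mem_subdiffNorm_iff] at hs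
      have : 1 / ε * (‖w x • s‖ - w x) ≤ 0 := by
        refine mul_nonpos_of_nonneg_of_nonpos (by positivity) ?_
        rw [norm_smul, Real.norm_of_nonneg hw]
        nlinarith [hs.1]
      rw [smul_zero, zero_add, F, max_eq_right this, Real.zero_rpow hβ, zero_smul]
    · have hn : 0 < ‖q‖ := norm_pos_iff.2 hq
      rw [(mem_subdiffNorm_iff_of_ne_zero hq).1 hs]
      set t := ‖q‖ with ht
      have hA : 0 < ε * t ^ (α - 1) + w x := by positivity
      have hp : (ε * t ^ (α - 2)) • q + w x • t⁻¹ • q = (ε * t ^ (α - 1) + w x) • t⁻¹ • q := by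
        rw [smul_smul, smul_smul, ← add_smul, ← h3 t hn]
        congr 1
        field_simp
      have hnu : ‖t⁻¹ • q‖ = 1 := by
        rw [norm_smul, norm_inv, norm_norm, ← ht, inv_mul_cancel₀ hn.ne']
      have hnp : ‖(ε * t ^ (α - 1) + w x) • t⁻¹ • q‖ = ε * t ^ (α - 1) + w x := by
        rw [norm_smul, hnu, mul_one, Real.norm_of_nonneg hA.le]
      rw [hp, F, hnp, add_sub_cancel_right, one_div, inv_mul_cancel_left₀ hε.ne',
        max_eq_left (by positivity), ← Real.rpow_mul hn.le, hpow, Real.rpow_one,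
        inv_smul_smul₀ hA.ne', smul_inv_smul₀ hn.ne']
  · intro h
    rcases le_or_gt ‖p‖ (w x) with hle | hgt
    · have : 1 / ε * (‖p‖ - w x) ≤ 0 :=
        mul_nonpos_of_nonneg_of_nonpos (by positivity) (by linarith)
      rw [F, max_eq_right this, Real.zero_rpow hβ, zero_smul] at h
      subst h
      have := (subgradient_smul_norm_iff hw (q := (0 : E d)) (ξ := p)).1 fun z => by
        rw [norm_zero, mul_zero, zero_add, sub_zero]
        exact (real_inner_le_norm p z).trans (by gcongr)
      obtain ⟨s, hs, hps⟩ := this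
      exact ⟨s, hs, by rw [smul_zero, zero_add, hps]⟩
    · have hp : 0 < ‖p‖ := hw.trans_lt hgt
      have hpos : 0 < 1 / ε * (‖p‖ - w x) := mul_pos (by positivity) (by linarith)
      rw [F, max_eq_left hpos.le] at h
      set u := 1 / ε * (‖p‖ - w x) with hu
      have ht : 0 < u ^ (α.conjExponent - 1) := Real.rpow_pos_of_pos hpos _
      have hnu : ‖‖p‖⁻¹ • p‖ = 1 := by
        rw [norm_smul, norm_inv, norm_norm, inv_mul_cancel₀ hp.ne']
      have hnq : ‖q‖ = u ^ (α.conjExponent - 1) := by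
        rw [h, norm_smul, hnu, mul_one, Real.norm_of_nonneg ht.le]
      have hq1 : ‖q‖ ^ (α - 1) = u := by
        rw [hnq, ← Real.rpow_mul hpos.le, mul_comm, hpow, Real.rpow_one]
      have hq : 0 < ‖q‖ := by rw [hnq]; exact ht
      have hdir : ‖q‖⁻¹ • q = ‖p‖⁻¹ • p := by
        rw [hnq]; nth_rewrite 1 [h]; rw [inv_smul_smul₀ ht.ne']
      refine ⟨‖q‖⁻¹ • q, normalize_mem_subdiffNorm q, ?_⟩
      have hfirst : (ε * ‖q‖ ^ (α - 2)) • q = (ε * u) • ‖q‖⁻¹ • q := by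
        rw [← hq1, ← h3 _ hq, smul_smul]
        congr 1
        field_simp
      rw [hfirst, ← add_smul, hdir, hu, one_div, mul_inv_cancel_left₀ hε.ne', sub_add_cancel,
        smul_inv_smul₀ hp.ne']

/-- A subgradient of `W |·| + (ε / α) |·|^α` is the sum of the gradient of the power and a
subgradient of `W |·|`. -/
theorem subgradient_sub_gradient {α ε W : ℝ} (hα : 1 < α) (hW : 0 ≤ W) {q η : E d}
    (h : ∀ z, W * ‖q‖ + ε / α * ‖q‖ ^ α + ⟪η, z - q⟫ ≤ W * ‖z‖ + ε / α * ‖z‖ ^ α) (z : E d) :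
    W * ‖q‖ + ⟪η - (ε * ‖q‖ ^ (α - 2)) • q, z - q⟫ ≤ W * ‖z‖ := by
  set r := z - q with hr
  -- The slack in `h` along the segment, with the nonsmooth term `W|·|` replaced by its chord.
  -- Convexity keeps it nonnegative on `(0, 1]`; it vanishes at `0` and is differentiable there
  -- since `α > 1`, so its derivative at `0` is nonnegative.
  let φ : ℝ → ℝ := fun t =>
    t * (W * (‖z‖ - ‖q‖)) + ε / α * (‖q + t • r‖ ^ α - ‖q‖ ^ α) - t * ⟪η, r⟫
  have hφ : ∀ t ∈ Set.Ioc (0 : ℝ) 1, 0 ≤ φ t := by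
    rintro t ⟨ht0, ht1⟩
    have h1 := h (q + t • r)
    have h2 : ‖q + t • r‖ ≤ (1 - t) * ‖q‖ + t * ‖z‖ := by
      have : q + t • r = (1 - t) • q + t • z := by rw [hr]; module
      rw [this]
      refine (norm_add_le _ _).trans ?_
      rw [norm_smul, norm_smul, Real.norm_of_nonneg ht0.le, Real.norm_of_nonneg (by linarith)]
    rw [add_sub_cancel_left, inner_smul_right] at h1
    have h3 := mul_le_mul_of_nonneg_left h2 hW
    simp only [φ]
    linarith
  have hd : HasDerivAt φ (W * (‖z‖ - ‖q‖) + ε / α * (α * ‖q‖ ^ (α - 2) * ⟪q, r⟫) - ⟪η, r⟫) 0 := by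
    have hn := hasFDerivAt_norm_rpow (q + (0 : ℝ) • r) hα
    have hl : HasDerivAt (fun t : ℝ => q + t • r) r 0 := by
      simpa using ((hasDerivAt_id (0 : ℝ)).smul_const r).const_add q
    have hc := hn.comp_hasDerivAt (0 : ℝ) hl
    rw [zero_smul, add_zero] at hc
    have h1 := ((hasDerivAt_id (0 : ℝ)).mul_const (W * (‖z‖ - ‖q‖))).add
      ((hc.sub_const (‖q‖ ^ α)).const_mul (ε / α))
    have h2 := h1.sub ((hasDerivAt_id (0 : ℝ)).mul_const ⟪η, r⟫)
    refine h2.congr_deriv ?_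
    simp [innerSL_apply_apply]
  have h0 : φ 0 = 0 := by simp [φ]
  have hlim := hd.tendsto_slope_zero_right
  have hge : 0 ≤ W * (‖z‖ - ‖q‖) + ε / α * (α * ‖q‖ ^ (α - 2) * ⟪q, r⟫) - ⟪η, r⟫ := by
    refine ge_of_tendsto hlim ?_
    filter_upwards [Ioc_mem_nhdsGT (zero_lt_one : (0 : ℝ) < 1)] with t ht
    rw [zero_add, h0, sub_zero, smul_eq_mul]
    exact mul_nonneg (inv_nonneg.2 ht.1.le) (hφ t ht)
  have hα0 : α ≠ 0 := by linarith
  have : ε / α * (α * ‖q‖ ^ (α - 2) * ⟪q, r⟫) = ε * ‖q‖ ^ (α - 2) * ⟪q, r⟫ := by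
    field_simp
  rw [this] at hge
  rw [inner_sub_left, real_inner_smul_left]
  linarith

/-- A continuous convex function that is minimal at `q` along a subspace has a subgradient at `q`
vanishing on the subspace. -/
theorem exists_subgradient_eq_zero_on {V : Type*} [NormedAddCommGroup V] [NormedSpace ℝ V]
    {J : V → ℝ} (hconv : ConvexOn ℝ Set.univ J) (hcont : Continuous J) (K : Submodule ℝ V) (q : V)
    (hmin : ∀ r ∈ K, J q ≤ J (q + r)) :
    ∃ η : StrongDual ℝ V, (∀ r ∈ K, η r = 0) ∧ ∀ p, J q + η (p - q) ≤ J p := by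
  let s : Set (V × ℝ) := {z | J z.1 < z.2}
  let t : Set (V × ℝ) := {z | z.1 - q ∈ K ∧ z.2 = J q}
  have hs1 : Convex ℝ s := by simpa [s] using hconv.convex_strict_epigraph
  have hs2 : IsOpen s := isOpen_lt (hcont.comp continuous_fst) continuous_snd
  have ht : Convex ℝ t := by
    rintro ⟨a, x⟩ ⟨ha, hx⟩ ⟨b, y⟩ ⟨hb, hy⟩ u v hu hv huv
    refine ⟨?_, ?_⟩
    · have : u • a + v • b - q = u • (a - q) + v • (b - q) := by
        have hv' : v = 1 - u := by linarith
        rw [hv']; module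
      change u • a + v • b - q ∈ K
      rw [this]
      exact K.add_mem (K.smul_mem _ ha) (K.smul_mem _ hb)
    · change u * x + v * y = J q
      simp only at hx hy
      rw [hx, hy, ← add_mul, huv, one_mul]
  have hdisj : Disjoint s t := by
    rw [Set.disjoint_left]
    rintro ⟨a, x⟩ h1 ⟨h2, h3⟩
    have := hmin _ h2
    rw [add_sub_cancel] at this
    simp only [s, Set.mem_ofPred_eq] at h1 h3
    linarith
  obtain ⟨f, u, hfs, hft⟩ := geometric_hahn_banach_open hs1 hs2 ht hdisj
  let g : StrongDual ℝ V := f.comp (ContinuousLinearMap.inl ℝ V ℝ)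
  set c : ℝ := f (0, 1) with hc
  have hf : ∀ a x, f (a, x) = g a + x * c := by
    intro a x
    have : ((a, x) : V × ℝ) = (a, 0) + x • (0, 1) := by simp
    rw [this, map_add, map_smul]
    rfl
  -- Comparing heights `J q + 1` and `J q` above `q` rules out a vertical hyperplane.
  have hcneg : c < 0 := by
    have h1 := hfs (q, J q + 1) (by simp [s])
    have h2 := hft (q, J q) ⟨by simp, rfl⟩
    rw [hf] at h1 h2
    linarith
  have hg0 : ∀ r ∈ K, g r = 0 := by
    intro r hr
    by_contra hne
    -- The coefficient makes `f` equal to `u - 1` at a point of `t`, where `f ≥ u`.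
    have h2 := hft (q + ((u - 1 - J q * c - g q) / g r) • r, J q)
      ⟨by rw [add_sub_cancel_left]; exact K.smul_mem _ hr, rfl⟩
    rw [hf, map_add, map_smul, smul_eq_mul, div_mul_cancel₀ _ hne] at h2
    linarith
  have hu : u ≤ g q + J q * c := by
    have := hft (q, J q) ⟨by simp, rfl⟩
    rwa [hf] at this
  refine ⟨(-c)⁻¹ • g, fun r hr => ?_, fun p => ?_⟩
  · rw [smul_apply, hg0 r hr, smul_zero]
  -- The margin `δ` is needed because the graph point `(p, J p)` is not in the strict epigraph.
  · refine le_of_forall_pos_lt_add fun δ hδ => ?_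
    have := hfs (p, J p + δ) (by simpa [s] using hδ)
    rw [hf] at this
    rw [smul_apply, smul_eq_mul, map_sub]
    have hc' : 0 < -c := by linarith
    have h4 : (-c)⁻¹ * (g p - g q) < J p + δ - J q := by
      rw [inv_mul_lt_iff₀ hc']
      linarith
    linarith

end Pointwise

/-! ### Integral functionals and their pointwise subgradients -/

section IntegralFunctional

variable {d : ℕ} {X : Type*} [MeasurableSpace X] {μ : Measure X}

theorem integrable_norm_rpow {α : ℝ} (hα : 1 < α) {p : X → E d}
    (hp : MemLp p (ENNReal.ofReal α) μ) : Integrable (fun x => ‖p x‖ ^ α) μ := by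
  have := hp.integrable_norm_rpow (by simp; linarith) ENNReal.ofReal_ne_top
  rwa [ENNReal.toReal_ofReal (by linarith)] at this

theorem integrable_weight_mul_norm [IsFiniteMeasure μ] {α C : ℝ} (hα : 1 < α) {w : X → ℝ}
    (hwm : AEStronglyMeasurable w μ) (hwb : ∀ᵐ x ∂μ, ‖w x‖ ≤ C) {p : X → E d}
    (hp : MemLp p (ENNReal.ofReal α) μ) : Integrable (fun x => w x * ‖p x‖) μ :=
  (hp.integrable (by simpa using hα.le)).norm.bdd_mul hwm hwb

theorem integrable_inner {α : ℝ} [Fact (1 < α)] {η p : X → E d}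
    (hη : MemLp η (ENNReal.ofReal α.conjExponent) μ) (hp : MemLp p (ENNReal.ofReal α) μ) :
    Integrable (fun x => ⟪η x, p x⟫) μ :=
  memLp_one_iff_integrable.1 ((innerSL ℝ).memLp_of_bilin 1 hη hp)

/-- A subgradient of the integral functional `p ↦ ∫ w |p| + c |p|^α` is almost everywhere a
subgradient of the integrand. -/
theorem ae_subgradient_of_integral [IsFiniteMeasure μ] {α C c : ℝ} [hα : Fact (1 < α)] {w : X → ℝ}
    (hwm : AEStronglyMeasurable w μ) (hwb : ∀ᵐ x ∂μ, ‖w x‖ ≤ C) {q η : X → E d}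
    (hq : MemLp q (ENNReal.ofReal α) μ) (hη : MemLp η (ENNReal.ofReal α.conjExponent) μ)
    (h : ∀ p : X → E d, MemLp p (ENNReal.ofReal α) μ →
      (∫ x, w x * ‖q x‖ + c * ‖q x‖ ^ α ∂μ) + (∫ x, ⟪η x, p x - q x⟫ ∂μ) ≤
        ∫ x, w x * ‖p x‖ + c * ‖p x‖ ^ α ∂μ) :
    ∀ᵐ x ∂μ, ∀ z : E d, w x * ‖q x‖ + c * ‖q x‖ ^ α + ⟪η x, z - q x⟫ ≤
      w x * ‖z‖ + c * ‖z‖ ^ α := by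
  classical
  have hint : ∀ p : X → E d, MemLp p (ENNReal.ofReal α) μ →
      Integrable (fun x => w x * ‖p x‖ + c * ‖p x‖ ^ α) μ := fun p hp =>
    (integrable_weight_mul_norm hα.out hwm hwb hp).add
      ((integrable_norm_rpow hα.out hp).const_mul c)
  have hz : ∀ z : E d, ∀ᵐ x ∂μ, 0 ≤ (w x * ‖z‖ + c * ‖z‖ ^ α) - (w x * ‖q x‖ + c * ‖q x‖ ^ α) -
      ⟪η x, z - q x⟫ := by
    intro z
    have hzm : MemLp (fun _ : X => z) (ENNReal.ofReal α) μ := memLp_const z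
    have hD : Integrable (fun x => (w x * ‖z‖ + c * ‖z‖ ^ α) -
        (w x * ‖q x‖ + c * ‖q x‖ ^ α) - ⟪η x, z - q x⟫) μ :=
      ((hint _ hzm).sub (hint q hq)).sub (integrable_inner hη (hzm.sub hq))
    refine ae_nonneg_of_forall_setIntegral_nonneg hD fun A hA _ => ?_
    -- The competitor changes `q` to `z` only on `A`, so the global inequality reduces to one over
    -- `A`.
    have hp : MemLp (A.piecewise (fun _ => z) q) (ENNReal.ofReal α) μ :=
      MemLp.piecewise hA (hzm.restrict _) (hq.restrict _)
    have h1 := h _ hp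
    have hi := integrable_inner hη (hp.sub hq)
    simp only [Pi.sub_apply] at hi
    rw [← sub_nonneg, sub_add_eq_sub_sub, ← integral_sub (hint _ hp) (hint q hq)] at h1
    rw [← integral_sub (by exact (hint _ hp).sub (hint q hq)) hi] at h1
    refine h1.trans_eq ?_
    rw [← integral_indicator hA]
    refine integral_congr_ae (.of_forall fun x => ?_)
    by_cases hx : x ∈ A <;> simp [hx]
  -- The exceptional null set depends on `z`; a countable dense set of `z` and continuity give a
  -- common one.
  obtain ⟨D, hDc, hDd⟩ := TopologicalSpace.exists_countable_dense (E d)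
  have hall : ∀ᵐ x ∂μ, ∀ z ∈ D, 0 ≤ (w x * ‖z‖ + c * ‖z‖ ^ α) -
      (w x * ‖q x‖ + c * ‖q x‖ ^ α) - ⟪η x, z - q x⟫ :=
    (ae_ball_iff hDc).2 fun z _ => hz z
  filter_upwards [hall] with x hx z
  have hα0 : 0 ≤ α := by linarith [hα.out]
  have hcont : Continuous fun z : E d => (w x * ‖z‖ + c * ‖z‖ ^ α) -
      (w x * ‖q x‖ + c * ‖q x‖ ^ α) - ⟪η x, z - q x⟫ := by
    have : Continuous fun z : E d => ‖z‖ ^ α := continuous_norm.rpow_const fun _ => .inr hα0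
    fun_prop
  have hcl : IsClosed {z : E d | 0 ≤ (w x * ‖z‖ + c * ‖z‖ ^ α) -
      (w x * ‖q x‖ + c * ‖q x‖ ^ α) - ⟪η x, z - q x⟫} := isClosed_le continuous_const hcont
  have : z ∈ {z : E d | 0 ≤ (w x * ‖z‖ + c * ‖z‖ ^ α) -
      (w x * ‖q x‖ + c * ‖q x‖ ^ α) - ⟪η x, z - q x⟫} :=
    hcl.closure_subset_iff.2 (fun y hy => hx y hy) (hDd z)
  have h0 : 0 ≤ (w x * ‖z‖ + c * ‖z‖ ^ α) -
      (w x * ‖q x‖ + c * ‖q x‖ ^ α) - ⟪η x, z - q x⟫ := this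
  linarith

theorem integral_subgradient_of_ae [IsFiniteMeasure μ] {α C : ℝ} [hα : Fact (1 < α)] {w : X → ℝ}
    (hwm : AEStronglyMeasurable w μ) (hwb : ∀ᵐ x ∂μ, ‖w x‖ ≤ C) {p q ξ : X → E d}
    (hp : MemLp p (ENNReal.ofReal α) μ) (hq : MemLp q (ENNReal.ofReal α) μ)
    (hξ : MemLp ξ (ENNReal.ofReal α.conjExponent) μ)
    (h : ∀ᵐ x ∂μ, ∀ z : E d, w x * ‖q x‖ + ⟪ξ x, z - q x⟫ ≤ w x * ‖z‖) :
    (∫ x, w x * ‖q x‖ ∂μ) + (∫ x, ⟪ξ x, p x - q x⟫ ∂μ) ≤ ∫ x, w x * ‖p x‖ ∂μ := by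
  have h1 := integrable_weight_mul_norm hα.out hwm hwb hq
  have h2 := integrable_inner hξ (hp.sub hq)
  simp only [Pi.sub_apply] at h2
  rw [← integral_add h1 h2]
  refine integral_mono_ae (h1.add h2) (integrable_weight_mul_norm hα.out hwm hwb hp) ?_
  filter_upwards [h] with x hx
  exact hx (p x)

/-- `|q|^{α-2} q` lies in `L^{α'}` when `q` lies in `L^α`. -/
theorem memLp_norm_rpow_smul {α : ℝ} [hα : Fact (1 < α)] {q : X → E d}
    (hq : MemLp q (ENNReal.ofReal α) μ) (ε : ℝ) :
    MemLp (fun x => (ε * ‖q x‖ ^ (α - 2)) • q x) (ENNReal.ofReal α.conjExponent) μ := by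
  have hc := Real.HolderConjugate.conjExponent hα.out
  have hm : AEStronglyMeasurable (fun x => (ε * ‖q x‖ ^ (α - 2)) • q x) μ :=
    ((hq.1.norm.aemeasurable.pow_const _).const_mul ε).aestronglyMeasurable.smul hq.1
  rw [← integrable_norm_rpow_iff hm (by simpa using hc.symm.pos) ENNReal.ofReal_ne_top,
    ENNReal.toReal_ofReal hc.symm.nonneg]
  refine ((integrable_norm_rpow hα.out hq).const_mul (|ε| ^ α.conjExponent)).congr
    (.of_forall fun x => ?_)
  simp only
  -- Zeros of `q` are separated because merging the powers into `|q|^{α-1}` needs a positive base;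
  -- then `(α-1)α' = α`.
  rcases eq_or_ne (q x) 0 with h | h
  · simp [h, Real.zero_rpow hc.pos.ne', Real.zero_rpow hc.symm.pos.ne']
  · have hn : 0 < ‖q x‖ := norm_pos_iff.2 h
    have h1 : ‖(ε * ‖q x‖ ^ (α - 2)) • q x‖ = |ε| * ‖q x‖ ^ (α - 1) := by
      rw [norm_smul, norm_mul, Real.norm_eq_abs, Real.norm_of_nonneg (by positivity), mul_assoc]
      congr 1
      nth_rewrite 2 [← Real.rpow_one ‖q x‖]
      rw [← Real.rpow_add hn]; congr 1; ring
    rw [h1, Real.mul_rpow (abs_nonneg _) (by positivity), ← Real.rpow_mul hn.le,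
      hc.sub_one_mul_conj]

/-- The map `p ↦ |p|` is continuous on `L^α`, and the bounded weight acts on it as an element of
`L^{α'}`. -/
theorem continuous_integral_weight_mul_norm [IsFiniteMeasure μ] {α C : ℝ} [hα : Fact (1 < α)] {w : X → ℝ}
    (hwm : AEStronglyMeasurable w μ) (hwb : ∀ᵐ x ∂μ, ‖w x‖ ≤ C) :
    Continuous fun p : Lp (E d) (ENNReal.ofReal α) μ => ∫ x, w x * ‖p x‖ ∂μ := by
  have hw : MemLp w (ENNReal.ofReal α.conjExponent) μ := MemLp.of_bound hwm C hwb
  have hl : LipschitzWith 1 (fun v : E d => ‖v‖) := lipschitzWith_one_norm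
  have hn := hl.continuous_compLp (p := ENNReal.ofReal α) (μ := μ) norm_zero
  have := (((ContinuousLinearMap.mul ℝ ℝ).lpPairing μ (ENNReal.ofReal α.conjExponent)
    (ENNReal.ofReal α)) (hw.toLp w)).continuous.comp hn
  refine this.congr fun p => ?_
  rw [Function.comp_apply, ContinuousLinearMap.lpPairing_eq_integral]
  refine integral_congr_ae ?_
  filter_upwards [hw.coeFn_toLp, hl.coeFn_compLp norm_zero p] with x h1 h2
  rw [h1, h2]
  rfl

theorem continuous_integral_norm_rpow {α : ℝ} [hα : Fact (1 < α)] :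
    Continuous fun p : Lp (E d) (ENNReal.ofReal α) μ => ∫ x, ‖p x‖ ^ α ∂μ := by
  have hα0 : 0 < α := by linarith [hα.out]
  have : Continuous fun p : Lp (E d) (ENNReal.ofReal α) μ => ‖p‖ ^ α :=
    continuous_norm.rpow_const fun _ => .inr hα0.le
  refine this.congr fun p => ?_
  have hI : 0 ≤ ∫ x, ‖p x‖ ^ α ∂μ := integral_nonneg fun x => by positivity
  rw [Lp.norm_def, (Lp.memLp p).eLpNorm_eq_integral_rpow_norm (by simpa using hα0)
    ENNReal.ofReal_ne_top, ENNReal.toReal_ofReal hα0.le, ENNReal.toReal_ofReal (by positivity),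
    ← Real.rpow_mul hI, inv_mul_cancel₀ hα0.ne', Real.rpow_one]

theorem convexOn_integral_functional [IsFiniteMeasure μ] {α C c : ℝ} [hα : Fact (1 < α)] (hc : 0 ≤ c) {w : X → ℝ}
    (hwm : AEStronglyMeasurable w μ) (hwb : ∀ᵐ x ∂μ, ‖w x‖ ≤ C) (hw0 : ∀ᵐ x ∂μ, 0 ≤ w x) :
    ConvexOn ℝ Set.univ fun p : Lp (E d) (ENNReal.ofReal α) μ =>
      (∫ x, w x * ‖p x‖ ∂μ) + c * ∫ x, ‖p x‖ ^ α ∂μ := by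
  have hα0 : 0 < α := by linarith [hα.out]
  have i1 := fun p : Lp (E d) (ENNReal.ofReal α) μ =>
    integrable_weight_mul_norm hα.out hwm hwb (Lp.memLp p)
  have i2 := fun p : Lp (E d) (ENNReal.ofReal α) μ => integrable_norm_rpow hα.out (Lp.memLp p)
  have hn : ∀ p p' : Lp (E d) (ENNReal.ofReal α) μ, ∀ a b : ℝ, 0 ≤ a → 0 ≤ b →
      ∀ᵐ x ∂μ, ‖(a • p + b • p') x‖ ≤ a * ‖p x‖ + b * ‖p' x‖ := by
    intro p p' a b ha hb
    filter_upwards [Lp.coeFn_add (a • p) (b • p'), Lp.coeFn_smul a p, Lp.coeFn_smul b p']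
      with x h1 h2 h3
    rw [h1, Pi.add_apply, h2, h3, Pi.smul_apply, Pi.smul_apply]
    refine (norm_add_le _ _).trans_eq ?_
    rw [norm_smul, norm_smul, Real.norm_of_nonneg ha, Real.norm_of_nonneg hb]
  refine ConvexOn.add ⟨convex_univ, ?_⟩ (ConvexOn.smul hc ⟨convex_univ, ?_⟩)
  · intro p _ p' _ a b ha hb hab
    simp only [smul_eq_mul]
    rw [← integral_const_mul, ← integral_const_mul,
      ← integral_add ((i1 p).const_mul a) ((i1 p').const_mul b)]
    refine integral_mono_ae (i1 _) (((i1 p).const_mul a).add ((i1 p').const_mul b)) ?_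
    filter_upwards [hn p p' a b ha hb, hw0] with x h1 h2
    have := mul_le_mul_of_nonneg_left h1 h2
    linarith
  · intro p _ p' _ a b ha hb hab
    simp only [smul_eq_mul]
    rw [← integral_const_mul, ← integral_const_mul,
      ← integral_add ((i2 p).const_mul a) ((i2 p').const_mul b)]
    refine integral_mono_ae (i2 _) (((i2 p).const_mul a).add ((i2 p').const_mul b)) ?_
    filter_upwards [hn p p' a b ha hb] with x h1
    refine (Real.rpow_le_rpow (norm_nonneg _) h1 hα0.le).trans ?_
    exact (convexOn_rpow hα.out.le).2 (norm_nonneg _) (norm_nonneg _) ha hb hab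

/-- Nonnegativity of `w` gives `|F(x,p)| ≤ (|p|/ε)^{α'-1}`, and `(α'-1)α = α'`. -/
theorem memLp_F {α ε : ℝ} [hα : Fact (1 < α)] (hε : 0 < ε) {w : E d → ℝ}
    {ν : Measure (E d)}
    (hwm : AEStronglyMeasurable w ν) (hw0 : ∀ᵐ x ∂ν, 0 ≤ w x) {p : E d → E d}
    (hp : MemLp p (ENNReal.ofReal α.conjExponent) ν) :
    MemLp (fun x => F α ε w x (p x)) (ENNReal.ofReal α) ν := by
  have hc := Real.HolderConjugate.conjExponent hα.out
  have hβ : 0 < α.conjExponent - 1 := by linarith [hc.symm.lt]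
  have hnm := hp.1.norm.aemeasurable
  have hm : AEStronglyMeasurable (fun x => F α ε w x (p x)) ν :=
    ((((hnm.sub hwm.aemeasurable).const_mul (1 / ε)).max aemeasurable_const).pow_const
      _).aestronglyMeasurable.smul (hnm.inv.aestronglyMeasurable.smul hp.1)
  rw [← integrable_norm_rpow_iff hm (by simpa using hc.pos) ENNReal.ofReal_ne_top,
    ENNReal.toReal_ofReal hc.nonneg]
  have hb := (integrable_norm_rpow hc.symm.lt hp).const_mul ((1 / ε) ^ α.conjExponent)
  refine hb.mono' ((hm.norm.aemeasurable.pow_const _).aestronglyMeasurable) ?_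
  filter_upwards [hw0] with x hx
  have h1 : ‖F α ε w x (p x)‖ ≤ (1 / ε * ‖p x‖) ^ (α.conjExponent - 1) := by
    have h2 : ‖‖p x‖⁻¹ • p x‖ ≤ 1 := by
      rw [norm_smul, norm_inv, norm_norm]
      exact inv_mul_le_one
    rw [F, norm_smul, Real.norm_of_nonneg (by positivity)]
    refine (mul_le_of_le_one_right (by positivity) h2).trans ?_
    refine Real.rpow_le_rpow (by positivity) (max_le ?_ (by positivity)) hβ.le
    gcongr
    linarith
  rw [Real.norm_of_nonneg (by positivity)]
  refine (Real.rpow_le_rpow (norm_nonneg _) h1 hc.nonneg).trans_eq ?_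
  rw [← Real.rpow_mul (by positivity), hc.symm.sub_one_mul_conj,
    Real.mul_rpow (by positivity) (norm_nonneg _)]

end IntegralFunctional

/-! ### Optimality system and Lagrange multiplier -/

section Optimality

variable {d : ℕ} {Ω : Set (E d)}

/-- Localization with no power term gives one direction; integrating the pointwise inequality gives
the other. -/
theorem inSubdiffWeightedL1_iff {α C : ℝ} [hα : Fact (1 < α)]
    [IsFiniteMeasure (volume.restrict (interior Ω))] {w : E d → ℝ}
    (hwm : AEStronglyMeasurable w (volume.restrict (interior Ω)))
    (hwb : ∀ᵐ x ∂(volume.restrict (interior Ω)), ‖w x‖ ≤ C)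
    (hw0 : ∀ᵐ x ∂(volume.restrict (interior Ω)), 0 ≤ w x)
    (q : LVec α Ω) (ξ : LVec α.conjExponent Ω) :
    InSubdiffWeightedL1 α Ω w q ξ ↔
      ∀ᵐ x ∂(volume.restrict (interior Ω)), ∃ s ∈ subdiffNorm (q x), ξ x = w x • s := by
  have hiff : (∀ᵐ x ∂(volume.restrict (interior Ω)), ∃ s ∈ subdiffNorm (q x), ξ x = w x • s) ↔
      ∀ᵐ x ∂(volume.restrict (interior Ω)), ∀ z : E d,
        w x * ‖q x‖ + ⟪ξ x, z - q x⟫ ≤ w x * ‖z‖ := by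
    refine eventually_congr ?_
    filter_upwards [hw0] with x hx
    exact (subgradient_smul_norm_iff hx).symm
  rw [hiff]
  constructor
  · intro h
    have := ae_subgradient_of_integral (c := 0) hwm hwb (Lp.memLp q) (Lp.memLp ξ) fun p hp => by
      have h1 := h (hp.toLp p)
      have e1 : weightedL1 Ω w (hp.toLp p) = weightedL1 Ω w p :=
        integral_congr_ae (by filter_upwards [hp.coeFn_toLp] with x hx; rw [hx])
      have e2 : ∫ x in interior Ω, ⟪ξ x, hp.toLp p x - q x⟫ =
          ∫ x in interior Ω, ⟪ξ x, p x - q x⟫ :=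
        integral_congr_ae (by filter_upwards [hp.coeFn_toLp] with x hx; rw [hx])
      rw [e1, e2] at h1
      simpa only [zero_mul, add_zero, weightedL1] using h1
    simpa only [zero_mul, add_zero] using this
  · intro h p
    exact integral_subgradient_of_ae hwm hwb (Lp.memLp p) (Lp.memLp q) (Lp.memLp ξ) h

/-- The optimality system holds if and only if `q = F(·, -∇y)`. -/
theorem stationary_iff_ae_eq_F {α ε C : ℝ} [hα : Fact (1 < α)] (hε : 0 < ε)
    [IsFiniteMeasure (volume.restrict (interior Ω))] {w : E d → ℝ}
    (hwm : AEStronglyMeasurable w (volume.restrict (interior Ω)))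
    (hwb : ∀ᵐ x ∂(volume.restrict (interior Ω)), ‖w x‖ ≤ C)
    (hw0 : ∀ᵐ x ∂(volume.restrict (interior Ω)), 0 ≤ w x)
    (q : LVec α Ω) (y : W1 α.conjExponent Ω) :
    Stationary α ε Ω w q y ↔
      (q : E d → E d) =ᵐ[volume.restrict (interior Ω)] fun x => F α ε w x (-(y.grad x)) := by
  constructor
  · rintro ⟨ξ, hξ, hst⟩
    filter_upwards [(inSubdiffWeightedL1_iff hwm hwb hw0 q ξ).1 hξ, hst, hw0] with x h1 h2 hx
    obtain ⟨s, hs, hξs⟩ := h1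
    refine (exists_subgradient_iff_eq_F hα.out hε hx _ _).1 ⟨s, hs, ?_⟩
    rw [← hξs]
    exact (eq_neg_of_add_eq_zero_left h2).symm
  · intro h
    have hN := memLp_norm_rpow_smul (Lp.memLp q) ε
    -- The inclusion leaves no choice for `ξ`: it is the remainder `-∇y - ε|q|^{α-2}q`.
    have hξ := (Lp.memLp y.grad).neg.sub hN
    have key : ∀ᵐ x ∂(volume.restrict (interior Ω)),
        (ε * ‖q x‖ ^ (α - 2)) • q x + hξ.toLp _ x + y.grad x = 0 := by
      filter_upwards [hξ.coeFn_toLp] with x hx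
      rw [hx, Pi.sub_apply, Pi.neg_apply]
      abel
    refine ⟨hξ.toLp _, (inSubdiffWeightedL1_iff hwm hwb hw0 q _).2 ?_, key⟩
    filter_upwards [h, hw0, key] with x h1 hx h2
    obtain ⟨s, hs, hp⟩ := (exists_subgradient_iff_eq_F hα.out hε hx _ _).2 h1
    refine ⟨s, hs, ?_⟩
    rw [← eq_neg_iff_add_eq_zero, hp] at h2
    exact add_left_cancel h2

/-- The minimizer of the regularized Beckmann problem admits a Lagrange multiplier. -/
theorem exists_multiplier {α ε C : ℝ} [hα : Fact (1 < α)] (hε : 0 < ε)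
    (hΩ : Bornology.IsBounded (interior Ω)) (hN : NeumannSolvable α Ω) {w : E d → ℝ}
    (hwm : AEStronglyMeasurable w (volume.restrict (interior Ω)))
    (hwb : ∀ᵐ x ∂(volume.restrict (interior Ω)), ‖w x‖ ≤ C)
    (hw0 : ∀ᵐ x ∂(volume.restrict (interior Ω)), 0 ≤ w x) {μp μm : Measure (E d)}
    {q : LVec α Ω} (hq : IsSolution α ε Ω w μp μm q) :
    ∃ y : W1 α.conjExponent Ω, MeanZero y ∧ Stationary α ε Ω w q y := by
  have : IsFiniteMeasure (volume.restrict (interior Ω)) := ⟨by simpa using hΩ.measure_lt_top⟩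
  have hα0 : 0 < α := by linarith [hα.out]
  let J : LVec α Ω → ℝ := fun p => objective α ε Ω w p
  have hconv : ConvexOn ℝ Set.univ J := convexOn_integral_functional (by positivity) hwm hwb hw0
  have hcont : Continuous J := (continuous_integral_weight_mul_norm hwm hwb).add
    (continuous_integral_norm_rpow.const_mul (ε / α))
  -- Perturbations in `K` leave every divergence test unchanged, so `q + r` stays admissible.
  let K : Submodule ℝ (LVec α Ω) :=
    ⨅ φ : W1 α.conjExponent Ω, LinearMap.ker
      ((pairing α α.conjExponent Ω).flip φ.grad).toLinearMap
  have hK : ∀ r, r ∈ K ↔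
      ∀ φ : W1 α.conjExponent Ω, pairing α α.conjExponent Ω r φ.grad = 0 := fun r => by
    simp only [K, Submodule.mem_iInf, LinearMap.mem_ker]
    rfl
  have hmin : ∀ r ∈ K, J q ≤ J (q + r) := by
    intro r hr
    refine hq.2 (q + r) fun φ f hf hφf => ?_
    rw [← hq.1 φ f hf hφf, ← pairing_apply, ← pairing_apply, map_add,
      add_apply, (hK r).1 hr φ, add_zero]
  obtain ⟨g, hgK, hg⟩ := exists_subgradient_eq_zero_on hconv hcont K q hmin
  obtain ⟨η, hη⟩ := exists_LpVec_repr_dual (Fact.out : α.HolderConjugate α.conjExponent) g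
  have hηp : ∀ r, pairing α α.conjExponent Ω r η = g r := fun r => by
    rw [pairing_apply, hη]
    exact integral_congr_ae (.of_forall fun x => real_inner_comm _ _)
  obtain ⟨y, hy, hyη⟩ := exists_grad_eq_of_orthogonal α hΩ hN (-η) fun r hr => by
    rw [map_neg, hηp, hgK r ((hK r).2 hr), neg_zero]
  refine ⟨y, hy, ?_⟩
  have hobj : ∀ p : E d → E d, MemLp p (ENNReal.ofReal α) (volume.restrict (interior Ω)) →
      objective α ε Ω w p = ∫ x in interior Ω, w x * ‖p x‖ + ε / α * ‖p x‖ ^ α := fun p hp => by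
    rw [objective, weightedL1, ← integral_const_mul, integral_add
      (integrable_weight_mul_norm hα.out hwm hwb hp)
      ((integrable_norm_rpow hα.out hp).const_mul _)]
  have hpt := ae_subgradient_of_integral (c := ε / α) hwm hwb (Lp.memLp q) (Lp.memLp η)
    fun p hp => by
      have h1 := hg (hp.toLp p)
      have e1 : J (hp.toLp p) = objective α ε Ω w p := by
        simp only [J]
        rw [hobj _ (Lp.memLp _), hobj p hp]
        exact integral_congr_ae (by filter_upwards [hp.coeFn_toLp] with x hx; rw [hx])
      have e2 : g (hp.toLp p - q) = ∫ x in interior Ω, ⟪η x, p x - q x⟫ := by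
        rw [hη]
        refine integral_congr_ae ?_
        filter_upwards [hp.coeFn_toLp, Lp.coeFn_sub (hp.toLp p) q] with x hx hx'
        rw [hx', Pi.sub_apply, hx]
      rw [e1, e2, hobj p hp] at h1
      rw [← hobj _ (Lp.memLp q)]
      exact h1
  -- Removing the gradient of the power from `η` leaves the subgradient of `w|·|`; it cancels
  -- against `∇y = -η`.
  have hM := memLp_norm_rpow_smul (Lp.memLp q) ε
  have hξ := (Lp.memLp η).sub hM
  refine ⟨hξ.toLp _, (inSubdiffWeightedL1_iff hwm hwb hw0 q _).2 ?_, ?_⟩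
  · filter_upwards [hpt, hw0, hξ.coeFn_toLp] with x h1 hx h2
    rw [h2]
    exact (subgradient_smul_norm_iff hx).1 (subgradient_sub_gradient hα.out hx h1)
  · rw [hyη]
    filter_upwards [hξ.coeFn_toLp, Lp.coeFn_neg η] with x h1 h2
    rw [h1, h2, Pi.sub_apply, Pi.neg_apply]
    abel

end Optimality

end Beckmann

/-! ### The assembled theorem -/

theorem mainTheorem3 {d : ℕ} (hd : 0 < d)
    (Ω : Set (E d)) (hΩ : IsCompact Ω) (hreg : closure (interior Ω) = Ω)
    (hLip : IsLipschitzDomain (interior Ω))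
    (w : E d → ℝ) (hw : ContinuousOn w Ω) (hw0 : ∀ x ∈ Ω, 0 ≤ w x)
    (α ε : ℝ) [Fact (1 < α)] (hα : α * ((d : ℝ) - 1) < d) (hε : 0 < ε)
    (μp μm : Measure (E d)) [IsProbabilityMeasure μp] [IsProbabilityMeasure μm]
    (hμp : μp Ωᶜ = 0) (hμm : μm Ωᶜ = 0)
    (hNeumann : NeumannSolvable α Ω) :
    -- existence of the multiplier for the solution of the regularized Beckmann problem
    (∀ q : LVec α Ω, IsSolution α ε Ω w μp μm q →
      ∃ y : W1 α.conjExponent Ω, MeanZero y ∧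
        Stationary α ε Ω w q y ∧ HasDivergence α Ω q μp μm) ∧
    -- `F` is the single-valued inverse of the multi-valued map `q ↦ ε |q|^{α-2} q + w(x) ∂|q|`
    (∀ x ∈ Ω, ∀ p q : E d,
      (∃ s ∈ subdiffNorm q, p = (ε * ‖q‖ ^ (α - 2)) • q + w x • s) ↔ q = F α ε w x p) ∧
    -- the superposition operator of `F` maps `L^{α'}` to `L^α`
    (∀ p : LVec α.conjExponent Ω,
      MemLp (fun x => F α ε w x (p x)) (ENNReal.ofReal α) (volume.restrict (interior Ω))) ∧
    -- the optimality system is equivalent to `div F(-∇y) = μ`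
    (∀ (q : LVec α Ω) (y : W1 α.conjExponent Ω), MeanZero y →
      ((Stationary α ε Ω w q y ∧ HasDivergence α Ω q μp μm) ↔
        ((q : E d → E d) =ᵐ[volume.restrict (interior Ω)] (fun x => F α ε w x (-(y.grad x))) ∧
          HasDivergence α Ω (fun x => F α ε w x (-(y.grad x))) μp μm))) := by
  have hα1 : 1 < α := Fact.out
  have hbdd := hLip.isBounded
  have hsub : interior Ω ⊆ Ω := interior_subset
  have : IsFiniteMeasure (volume.restrict (interior Ω)) := ⟨by simpa using hbdd.measure_lt_top⟩
  have hwm : AEStronglyMeasurable w (volume.restrict (interior Ω)) :=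
    (hw.mono hsub).aestronglyMeasurable isOpen_interior.measurableSet
  obtain ⟨C, hC⟩ := hΩ.exists_bound_of_continuousOn hw
  have hmem : ∀ᵐ x ∂(volume.restrict (interior Ω)), x ∈ interior Ω :=
    ae_restrict_mem isOpen_interior.measurableSet
  have hwb : ∀ᵐ x ∂(volume.restrict (interior Ω)), ‖w x‖ ≤ C :=
    hmem.mono fun x hx => hC x (hsub hx)
  have hwn : ∀ᵐ x ∂(volume.restrict (interior Ω)), 0 ≤ w x :=
    hmem.mono fun x hx => hw0 x (hsub hx)
  refine ⟨fun q hq => ?_, fun x hx p q => exists_subgradient_iff_eq_F hα1 hε (hw0 x hx) p q,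
    fun p => memLp_F hε hwm hwn (Lp.memLp p), fun q y _ => ?_⟩
  · obtain ⟨y, hy, hst⟩ := exists_multiplier hε hbdd hNeumann hwm hwb hwn hq
    exact ⟨y, hy, hst, hq.1⟩
  · rw [stationary_iff_ae_eq_F hε hwm hwb hwn]
    -- Fields equal almost everywhere have the same integrals against gradients, so the divergence
    -- conditions coincide.
    refine and_congr_right fun h => ?_
    refine forall₄_congr fun φ f _ _ => ?_
    rw [integral_congr_ae (g := fun x => ⟪F α ε w x (-(y.grad x)), φ.grad x⟫)
      (by filter_upwards [h] with x hx; rw [hx])]
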